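/- **Setting.** Let $r\ge 1$, $d\ge 1$ be integers, $d=2q+p$, and let $i\mapsto i^*$ be the involution of $[d]=\{1,\dots,d\}$ with $i^*=i+q$ for $1\le i\le q$, $i^*=i-q$ for $q+1\le i\le 2q$ and $i^*=i$ for $2q+1\le i\le d$. Let $a_0,a_1,\dots,a_d\in M_r(\mathbb C)$ be arbitrary matrices. For a countable set $X$ and permutations $\sigma_1,\dots,\sigma_d$ of $X$ with $\sigma_{i^*}=\sigma_i^{-1}$ for all $i$, let $S_i$ be the unitary operator $(S_ig)(x)=g(\sigma_i(x))$ on $\ell^2(X)$, and set $$A=a_0\otimes 1+\sum_{i=1}^d a_i\otimes S_i\ \text{ on } \mathbb C^r\otimes\ell^2(X),\qquad B(b)=\sum_{i,j:\ j\ne i^*} b_j\otimes S_i\otimes E_{ij}\ \text{ on } \mathbb C^r\otimes\ell^2(X)\otimes\mathbb C^d$$ for weights $b=(b_1,\dots,b_d)\in M_r(\mathbb C)^d$, where $E_{ij}\in M_d(\mathbb C)$ are the matrix units. Let $X_\star$ be the free product of $q$ copies of $\mathbb Z$ and $p$ copies of $\mathbb Z/2\mathbb Z$, with unit $o$ and generators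 $g_1,\dots,g_d$, where $g_i$ and $g_{i+q}=g_i^{-1}$ generate the $i$-th copy of $\mathbb Z$ for $1\le i\le q$ and $g_{2q+1},\dots,g_d$ generate the copies of $\mathbb Z/2\mathbb Z$. Let $A_\star$ and $B_\star(b)$ be the operators $A$ and $B(b)$ for $X=X_\star$ and $\sigma_i(x)=g_ix$. For a bounded set $D\subset\mathbb C$ let $\mathrm{full}(D)$ be the complement of the unbounded connected component of $\mathbb C\setminus D$. For $\mu\notin\mathrm{full}(\sigma(A_\star))$ let $G(\mu)=(\mu-A_\star)^{-1}$, with $r\times r$ blocks $G_{xy}(\mu)=(1\otimes\langle\delta_x,\cdot\,\delta_y\rangle)(G(\mu))$, $x,y\in X_\star$. Call $\mu$ admissible if $\mu\notin\mathrm{full}(\sigma(A_\star))$ and the matrix $G_{oo}(\mu)$ is invertible; for such $\mu$ set $\hat a_i(\mu)=G_{oo}(\mu)^{-1}G_{og_i}(\mu)$, $B_\mu=B(\hat a(\mu))$ and $(B_\star)_\mu=B_\star(\hat a(\mu))$. Denote by $\rho$ the spectral radius. **Theorem.** (i) For every admissible $\mu$, $\rho((B_\star)_\mu)<1$. (ii)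 For every $\varepsilon>0$ there is $\delta>0$, depending only on $\varepsilon$ and on $r$, $q$, $p$, $a_0,\dots,a_d$, such that for every countable set $X$ and all permutations $\sigma_i$ as above: if $\rho(B_\mu)<\rho((B_\star)_\mu)+\delta$ for all admissible $\mu$, then $\mathrm{full}(\sigma(A))$ is contained in the $\varepsilon$-neighbourhood $\{z:\operatorname{dist}(z,\mathrm{full}(\sigma(A_\star)))<\varepsilon\}$ of $\mathrm{full}(\sigma(A_\star))$. Moreover, the same holds for restrictions. Let $U$ be a closed subspace of finite codimension of $\ell^2(X)$ with $S_iU=U$ for all $i$, $H=\mathbb C^r\otimes U$ and $K=\mathbb C^r\otimes U\otimes\mathbb C^d$. (i') If $X=X_\star$ and $\sigma_i(x)=g_ix$, then $\rho(((B_\star)_\mu)_{|K})<1$ for every admissible $\mu$. (ii') For every $\varepsilon>0$ there is $\delta>0$, depending only on $\varepsilon$ and on $r$, $q$, $p$, $a_0,\dots,a_d$, such that for all $X$, $\sigma_i$ and $U$ as above: if $\rho((B_\mu)_{|K})<\rho((B_\star)_\mu)+\delta$ for all admissible $\mu$, then $\mathrm{full}(\sigma(A_{|H}))$ is contained in the $\varepsilon$-neighbourhood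 of $\mathrm{full}(\sigma(A_\star))$. -/

import Mathlib

open scoped ENNReal

namespace NonBacktracking

noncomputable section

/-! ### Labels, the free product and its generators -/

/-- The label set `[d]`, `d = 2 q + p`: the labels `1, …, q`, then `q + 1, …, 2 q`, then the
`p` labels `2 q + 1, …, d`. -/
abbrev Label (q p : ℕ) : Type := (Fin q ⊕ Fin q) ⊕ Fin p

/-- The involution `i ↦ i*`: it exchanges `i` and `i + q` for `i ≤ q`, and fixes the last `p`
labels. -/
def Label.star {q p : ℕ} : Label q p → Label q p
  | .inl (.inl i) => .inl (.inr i)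
  | .inl (.inr i) => .inl (.inl i)
  | .inr i => .inr i

/-- The factors of the free product: `q` copies of `ℤ` and `p` copies of `ℤ / 2`, written
multiplicatively. -/
def Factor {q p : ℕ} : Fin q ⊕ Fin p → Type
  | .inl _ => Multiplicative ℤ
  | .inr _ => Multiplicative (ZMod 2)

instance {q p : ℕ} : (k : Fin q ⊕ Fin p) → Group (Factor k)
  | .inl _ => inferInstanceAs (Group (Multiplicative ℤ))
  | .inr _ => inferInstanceAs (Group (Multiplicative (ZMod 2)))

/-- The group `X⋆ = ℤ * ⋯ * ℤ * ℤ₂ * ⋯ * ℤ₂` (`q` copies of `ℤ`, `p` copies of `ℤ₂`). -/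
abbrev FreeProd (q p : ℕ) : Type := Monoid.CoprodI (Factor (q := q) (p := p))

/-- The generators `g_i` of `X⋆`. For `i ≤ q`, `g_i` and `g_{i+q} = g_i⁻¹` generate the `i`-th copy
of `ℤ`; the last `p` of them generate the copies of `ℤ₂`. -/
def gen {q p : ℕ} : Label q p → FreeProd q p
  | .inl (.inl i) => Monoid.CoprodI.of (M := Factor (q := q) (p := p)) (i := .inl i)
      (Multiplicative.ofAdd (1 : ℤ))
  | .inl (.inr i) => Monoid.CoprodI.of (M := Factor (q := q) (p := p)) (i := .inl i)
      (Multiplicative.ofAdd (-1 : ℤ))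
  | .inr i => Monoid.CoprodI.of (M := Factor (q := q) (p := p)) (i := .inr i)
      (Multiplicative.ofAdd (1 : ZMod 2))

/-! ### Hilbert spaces and operators -/

/-- The Hilbert space `ℓ²(X)`. -/
abbrev L2 (X : Type*) : Type _ := lp (fun _ : X => ℂ) 2

/-- The Hilbert space `ℂⁿ ⊗ ℓ²(X)`, as the space of `n`-tuples of elements of `ℓ²(X)` with the
Hilbert norm. -/
abbrev Amp (n : Type*) (X : Type*) : Type _ := PiLp 2 (fun _ : n => L2 X)

lemma memℓp_comp_perm {X : Type*} (σ : Equiv.Perm X) (g : L2 X) :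
    Memℓp (fun x => g (σ x)) 2 := by
  have h := (lp.memℓp g).summable (by norm_num)
  exact memℓp_gen (h.comp_injective σ.injective)

/-- The unitary operator `S` of a permutation `σ` on `ℓ²(X)`: `(S g)(x) = g (σ x)`. -/
def permOp {X : Type*} (σ : Equiv.Perm X) : L2 X →L[ℂ] L2 X :=
  LinearMap.mkContinuous
    { toFun := fun g => ⟨fun x => g (σ x), memℓp_comp_perm σ g⟩
      map_add' := fun _ _ => rfl
      map_smul' := fun _ _ => rfl } 1 (by
    intro g
    have h2 : (0 : ℝ) < (2 : ℝ≥0∞).toReal := by norm_num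
    rw [one_mul, ← Real.rpow_le_rpow_iff (norm_nonneg _) (norm_nonneg _) h2,
      lp.norm_rpow_eq_tsum h2, lp.norm_rpow_eq_tsum h2]
    exact (Equiv.tsum_eq σ (fun x => ‖g x‖ ^ (2 : ℝ≥0∞).toReal)).le)

@[simp] lemma permOp_apply {X : Type*} (σ : Equiv.Perm X) (g : L2 X) (x : X) :
    permOp σ g x = g (σ x) := rfl

/-- The operator `m ⊗ T` on `ℂⁿ ⊗ ℓ²(X)`, for an `n × n` matrix `m` and an operator `T` on
`ℓ²(X)`. -/
def tensorOp {n X : Type*} [Fintype n] (m : Matrix n n ℂ) (T : L2 X →L[ℂ] L2 X) :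
    Amp n X →L[ℂ] Amp n X :=
  ((PiLp.continuousLinearEquiv 2 ℂ (fun _ : n => L2 X)).symm : (n → L2 X) →L[ℂ] Amp n X).comp
    (ContinuousLinearMap.pi fun k =>
      ∑ l, m k l • T.comp (PiLp.proj (𝕜 := ℂ) 2 (fun _ : n => L2 X) l))

lemma tensorOp_apply {n X : Type*} [Fintype n] (m : Matrix n n ℂ) (T : L2 X →L[ℂ] L2 X)
    (f : Amp n X) (k : n) : tensorOp m T f k = ∑ l, m k l • T (f l) := by
  simp [tensorOp]

/-- The operator `A = a₀ ⊗ 1 + ∑ i, a_i ⊗ S_i` on `ℂʳ ⊗ ℓ²(X)`. -/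
def opA {r q p : ℕ} {X : Type*} (a₀ : Matrix (Fin r) (Fin r) ℂ)
    (a : Label q p → Matrix (Fin r) (Fin r) ℂ) (σ : Label q p → Equiv.Perm X) :
    Amp (Fin r) X →L[ℂ] Amp (Fin r) X :=
  tensorOp a₀ 1 + ∑ i, tensorOp (a i) (permOp (σ i))

/-- The non-backtracking operator `B = ∑_{j ≠ i*} a_j ⊗ S_i ⊗ E_{ij}` on
`ℂʳ ⊗ ℓ²(X) ⊗ ℂᵈ`. -/
def opB {r q p : ℕ} {X : Type*} (a : Label q p → Matrix (Fin r) (Fin r) ℂ)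
    (σ : Label q p → Equiv.Perm X) :
    Amp (Fin r × Label q p) X →L[ℂ] Amp (Fin r × Label q p) X :=
  ∑ i, ∑ j, if j ≠ i.star then
    tensorOp (Matrix.kroneckerMap (· * ·) (a j) (Matrix.single i j (1 : ℂ))) (permOp (σ i))
  else 0

/-- The permutations `x ↦ g_i x` of the group `X⋆`. -/
def freePerm {q p : ℕ} (i : Label q p) : Equiv.Perm (FreeProd q p) := Equiv.mulLeft (gen i)

/-- The free operator `A⋆`: the operator `A` for `X = X⋆` and `σ_i(x) = g_i x`. -/
def freeA {r q p : ℕ} (a₀ : Matrix (Fin r) (Fin r) ℂ) (a : Label q p → Matrix (Fin r) (Fin r) ℂ) :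
    Amp (Fin r) (FreeProd q p) →L[ℂ] Amp (Fin r) (FreeProd q p) :=
  opA a₀ a freePerm

/-- The free non-backtracking operator `B⋆`. -/
def freeB {r q p : ℕ} (a : Label q p → Matrix (Fin r) (Fin r) ℂ) :
    Amp (Fin r × Label q p) (FreeProd q p) →L[ℂ] Amp (Fin r × Label q p) (FreeProd q p) :=
  opB a freePerm

/-! ### Restrictions -/

/-- The subspace `ℂⁿ ⊗ U` of `ℂⁿ ⊗ ℓ²(X)`. -/
def ampSub (n : Type*) {X : Type*} (U : Submodule ℂ (L2 X)) : Submodule ℂ (Amp n X) where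
  carrier := {f | ∀ k, f k ∈ U}
  add_mem' hf hg k := U.add_mem (hf k) (hg k)
  zero_mem' _ := U.zero_mem
  smul_mem' c _ hf k := U.smul_mem c (hf k)

lemma tensorOp_mem {n X : Type*} [Fintype n] {U : Submodule ℂ (L2 X)} (m : Matrix n n ℂ)
    {T : L2 X →L[ℂ] L2 X} (hT : ∀ u ∈ U, T u ∈ U) (f : Amp n X) (hf : f ∈ ampSub n U) :
    tensorOp m T f ∈ ampSub n U := by
  intro k
  rw [tensorOp_apply]
  exact U.sum_mem fun l _ => U.smul_mem _ (hT _ (hf l))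

/-- `U` is left invariant by all the permutation operators: `S_i U = U`. -/
def Invariant {q p : ℕ} {X : Type*} (σ : Label q p → Equiv.Perm X) (U : Submodule ℂ (L2 X)) :
    Prop :=
  ∀ i, U.map (permOp (σ i)).toLinearMap = U

lemma Invariant.mem {q p : ℕ} {X : Type*} {σ : Label q p → Equiv.Perm X} {U : Submodule ℂ (L2 X)}
    (h : Invariant σ U) (i : Label q p) : ∀ u ∈ U, permOp (σ i) u ∈ U := by
  intro u hu
  rw [← h i]
  exact ⟨u, hu, rfl⟩

lemma opA_mem {r q p : ℕ} {X : Type*} (a₀ : Matrix (Fin r) (Fin r) ℂ)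
    (a : Label q p → Matrix (Fin r) (Fin r) ℂ) (σ : Label q p → Equiv.Perm X)
    {U : Submodule ℂ (L2 X)} (h : Invariant σ U) :
    ∀ f ∈ ampSub (Fin r) U, opA a₀ a σ f ∈ ampSub (Fin r) U := by
  intro f hf
  rw [opA, add_apply, sum_apply]
  exact Submodule.add_mem _ (tensorOp_mem _ (fun u hu => hu) f hf)
    (Submodule.sum_mem _ fun i _ => tensorOp_mem _ (h.mem i) f hf)

lemma opB_mem {r q p : ℕ} {X : Type*} (a : Label q p → Matrix (Fin r) (Fin r) ℂ)
    (σ : Label q p → Equiv.Perm X) {U : Submodule ℂ (L2 X)} (h : Invariant σ U) :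
    ∀ f ∈ ampSub (Fin r × Label q p) U, opB a σ f ∈ ampSub (Fin r × Label q p) U := by
  intro f hf
  rw [opB, sum_apply]
  refine Submodule.sum_mem _ fun i _ => ?_
  rw [sum_apply]
  refine Submodule.sum_mem _ fun j _ => ?_
  split_ifs
  · exact tensorOp_mem _ (h.mem i) f hf
  · exact Submodule.zero_mem _

/-- The restriction `A_{|H}` to `H = ℂʳ ⊗ U`, a bounded operator on `H`. -/
def restrA {r q p : ℕ} {X : Type*} (a₀ : Matrix (Fin r) (Fin r) ℂ)
    (a : Label q p → Matrix (Fin r) (Fin r) ℂ) (σ : Label q p → Equiv.Perm X)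
    (U : Submodule ℂ (L2 X)) (h : Invariant σ U) :
    ampSub (Fin r) U →L[ℂ] ampSub (Fin r) U :=
  (opA a₀ a σ).restrict (opA_mem a₀ a σ h)

/-- The restriction `B_{|K}` to `K = ℂʳ ⊗ U ⊗ ℂᵈ`, a bounded operator on `K`. -/
def restrB {r q p : ℕ} {X : Type*} (a : Label q p → Matrix (Fin r) (Fin r) ℂ)
    (σ : Label q p → Equiv.Perm X) (U : Submodule ℂ (L2 X)) (h : Invariant σ U) :
    ampSub (Fin r × Label q p) U →L[ℂ] ampSub (Fin r × Label q p) U :=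
  (opB a σ).restrict (opB_mem a σ h)

/-! ### Filled sets, block entries and the weights `â_i(μ)` -/

/-- `full D` for a bounded set `D` of complex numbers: the complement of the unbounded connected
component of the complement of `D`. (For `z ∈ D` the set `connectedComponentIn Dᶜ z` is empty.) -/
def full (D : Set ℂ) : Set ℂ :=
  {z | ¬ Bornology.IsBounded (connectedComponentIn Dᶜ z)}ᶜ

open Classical in
/-- The block `M_{xy} = (1 ⊗ ⟨δ_x, · δ_y⟩)(M)`, an `n × n` matrix. -/
def block {n X : Type*} [Fintype n] (M : Amp n X →L[ℂ] Amp n X) (x y : X) : Matrix n n ℂ :=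
  Matrix.of fun k l => M (WithLp.toLp 2 (Pi.single l (lp.single 2 y (1 : ℂ)))) k x

/-- The resolvent `G(μ) = (μ - A⋆)⁻¹`. -/
def freeG {r q p : ℕ} (a₀ : Matrix (Fin r) (Fin r) ℂ) (a : Label q p → Matrix (Fin r) (Fin r) ℂ)
    (μ : ℂ) : Amp (Fin r) (FreeProd q p) →L[ℂ] Amp (Fin r) (FreeProd q p) :=
  resolvent (freeA a₀ a) μ

/-- The block `G_{oo}(μ)`, where `o` is the neutral element of `X⋆`. -/
def Goo {r q p : ℕ} (a₀ : Matrix (Fin r) (Fin r) ℂ) (a : Label q p → Matrix (Fin r) (Fin r) ℂ)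
    (μ : ℂ) : Matrix (Fin r) (Fin r) ℂ :=
  block (freeG a₀ a μ) 1 1

/-- The weights `â_i(μ) = G_{oo}(μ)⁻¹ G_{o g_i}(μ)`. -/
def hatA {r q p : ℕ} (a₀ : Matrix (Fin r) (Fin r) ℂ) (a : Label q p → Matrix (Fin r) (Fin r) ℂ)
    (μ : ℂ) (i : Label q p) : Matrix (Fin r) (Fin r) ℂ :=
  (Goo a₀ a μ)⁻¹ * block (freeG a₀ a μ) 1 (gen i)

/-- The weights `â_i(μ)` are defined at `μ`: `μ` lies outside `full(σ(A⋆))` and the matrix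
`G_{oo}(μ)` is invertible. -/
def Admissible {r q p : ℕ} (a₀ : Matrix (Fin r) (Fin r) ℂ)
    (a : Label q p → Matrix (Fin r) (Fin r) ℂ) (μ : ℂ) : Prop :=
  μ ∉ full (spectrum ℂ (freeA a₀ a)) ∧ IsUnit (Goo a₀ a μ)

end

end NonBacktracking

namespace NonBacktracking

/-! ### Reduced words -/

section Words

variable {q p : ℕ}

/-! The Cayley graph of `X⋆` is a tree, and the weights are chosen so that the free resolvent is
multiplicative along it. Removing a vertex `y` separates the branches behind it from the origin,
whence `G_{o,g_j y} = G_{o,y} â_j` (`block_freeG_away`). So `G_{ox}` is `G_oo` times the product of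
the weights along the path from `o` to `x`. The row of `G(μ)` at `o` is square-summable, so the
squared products of weights, summed over the paths of length `n`, tend to `0`
(`tendsto_pathWeight_hatA`).

For (i), the edges are split into those pointing away from the origin and those pointing towards it.
`B⋆` preserves the functions carried by inward edges. The outward and the inward part of its `n`-th
power are controlled by the above sum: an outward edge has at most one outward predecessor, an
inward edge at most one inward successor. A block triangular operator with small diagonal powers has
a strictly contracting power (`exists_norm_pow_lt_one_of_triangular`). Norms of powers do not
increase on invariant subspaces, which gives (i').

For (ii), the formal inverse of `μ - A` is the sum over reduced words of `G_oo` times weights times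
shifts. The error of its truncation consists of sums over long non-backtracking paths
(`mul_sum_sphereOp`), which are entries of powers of `B_μ` (`Realization.pathOp_eq_sum`). Hence
`ρ(B_μ) < 1` yields a right inverse of `μ - A`. Since `G_oo` may be singular at isolated points, the
estimate is made on a circle of admissible points, where compactness gives one truncation length and
one `δ`. The maximum principle carries it into the disc (`Realization.exists_right_inverse`).

A right inverse becomes an inverse by connectedness, once the disc contains a point of the resolvent
set (`ball_subset_resolventSet`). The conclusion thus propagates from infinity through the unbounded
component, which is why filled spectra appear (`full_subset_thickening`). The structure
`Realization` keeps only the algebra that is needed, so that `ℓ²(X)` and its invariant subspaces are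
treated by the same argument. -/

@[simp] lemma Label.star_star (i : Label q p) : i.star.star = i := by
  rcases i with (i | i) | i <;> rfl

/-- Left multiplication of a reduced word by a letter. -/
def consWord (i : Label q p) : List (Label q p) → List (Label q p)
  | [] => [i]
  | j :: t => if j = i.star then t else i :: j :: t

/-- A word is reduced if no letter is followed by its inverse. -/
def IsReduced (l : List (Label q p)) : Prop := l.IsChain fun i j => j ≠ i.star

lemma IsReduced.consWord {l : List (Label q p)} (h : IsReduced l) (i : Label q p) :
    IsReduced (consWord i l) := by
  unfold IsReduced at *
  cases l with
  | nil => simp [NonBacktracking.consWord]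
  | cons j t =>
    by_cases hj : j = i.star
    · simpa [NonBacktracking.consWord, hj] using h.tail
    · simp only [NonBacktracking.consWord, hj, if_false]
      exact List.IsChain.cons_cons hj h

lemma consWord_star_consWord {l : List (Label q p)} (h : IsReduced l) (i : Label q p) :
    consWord i.star (consWord i l) = l := by
  cases l with
  | nil => simp [consWord]
  | cons j t =>
    by_cases hj : j = i.star
    · subst hj
      cases t with
      | nil => simp [consWord]
      | cons k t =>
        have : k ≠ i := by
          have h' := h
          unfold IsReduced at h'
          rw [List.isChain_cons_cons] at h'
          simpa using h'.1
        simp [consWord, this]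
    · simp [consWord, hj]

/-- The permutation of the reduced words given by left multiplication by a letter. -/
def wordPerm (i : Label q p) : Equiv.Perm {l : List (Label q p) // IsReduced l} where
  toFun l := ⟨consWord i l.1, l.2.consWord i⟩
  invFun l := ⟨consWord i.star l.1, l.2.consWord i.star⟩
  left_inv l := Subtype.ext (consWord_star_consWord l.2 i)
  right_inv l := Subtype.ext (by simpa using consWord_star_consWord l.2 i.star)

lemma wordPerm_star (i : Label q p) : wordPerm i.star = (wordPerm i)⁻¹ := by
  ext l : 1
  rfl

/-- The inclusion of a factor `ℤ` of the free product. -/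
def ofInt (i : Fin q) : Multiplicative ℤ →* FreeProd q p :=
  Monoid.CoprodI.of (M := Factor (q := q) (p := p)) (i := .inl i)

/-- The inclusion of a factor `ℤ / 2` of the free product. -/
def ofZMod (i : Fin p) : Multiplicative (ZMod 2) →* FreeProd q p :=
  Monoid.CoprodI.of (M := Factor (q := q) (p := p)) (i := .inr i)

lemma gen_inl_inl (i : Fin q) :
    gen (.inl (.inl i) : Label q p) = ofInt i (Multiplicative.ofAdd (1 : ℤ)) := rfl

lemma gen_inl_inr (i : Fin q) :
    gen (.inl (.inr i) : Label q p) = ofInt i (Multiplicative.ofAdd (-1 : ℤ)) := rfl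

lemma gen_inr (i : Fin p) :
    gen (.inr i : Label q p) = ofZMod i (Multiplicative.ofAdd (1 : ZMod 2)) := rfl

/-- The action of a factor `ℤ` on reduced words. -/
def intAction (i : Fin q) :
    Multiplicative ℤ →* Equiv.Perm {l : List (Label q p) // IsReduced l} :=
  zpowersHom _ (wordPerm (.inl (.inl i)))

/-- The action of a factor `ℤ / 2` on reduced words. -/
def zmodAction (i : Fin p) :
    Multiplicative (ZMod 2) →* Equiv.Perm {l : List (Label q p) // IsReduced l} :=
  AddMonoidHom.toMultiplicativeLeft (ZMod.lift 2
      ⟨zmultiplesHom (Additive (Equiv.Perm {l : List (Label q p) // IsReduced l}))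
        (Additive.ofMul (wordPerm (.inr i))), by
        have h : wordPerm (.inr i : Label q p) * wordPerm (.inr i) = 1 := by
          have := wordPerm_star (.inr i : Label q p)
          rw [eq_inv_iff_mul_eq_one] at this
          exact this
        rw [zmultiplesHom_apply, ← ofMul_zpow]
        norm_num [sq, zpow_ofNat, h]⟩)

/-- The action of a factor of the free product on reduced words. -/
def factorAction : (k : Fin q ⊕ Fin p) →
    Factor k →* Equiv.Perm {l : List (Label q p) // IsReduced l}
  | .inl i => intAction i
  | .inr i => zmodAction i

/-- The action of the free product on reduced words. -/
def wordAction : FreeProd q p →* Equiv.Perm {l : List (Label q p) // IsReduced l} :=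
  Monoid.CoprodI.lift factorAction

lemma wordAction_ofInt (i : Fin q) (m : Multiplicative ℤ) :
    wordAction (p := p) (ofInt i m) = intAction i m :=
  Monoid.CoprodI.lift_of (M := Factor (q := q) (p := p)) (i := .inl i) (fi := factorAction) m

lemma wordAction_ofZMod (i : Fin p) (m : Multiplicative (ZMod 2)) :
    wordAction (q := q) (ofZMod i m) = zmodAction i m :=
  Monoid.CoprodI.lift_of (M := Factor (q := q) (p := p)) (i := .inr i) (fi := factorAction) m

lemma wordAction_gen (i : Label q p) : wordAction (gen i) = wordPerm i := by
  rcases i with (i | i) | i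
  · rw [gen_inl_inl, wordAction_ofInt, intAction, zpowersHom_apply]; simp
  · rw [gen_inl_inr, wordAction_ofInt, intAction, zpowersHom_apply]
    exact (zpow_neg_one _).trans (wordPerm_star (.inl (.inl i))).symm
  · rw [gen_inr, wordAction_ofZMod, zmodAction]
    rw [show (1 : ZMod 2) = ((1 : ℤ) : ZMod 2) by norm_num]
    change Additive.toMul (ZMod.lift 2 _ ((1 : ℤ) : ZMod 2)) = _
    rw [ZMod.lift_coe]
    simp

/-- The reduced word of an element of the free product. -/
def wd (x : FreeProd q p) : List (Label q p) := (wordAction x ⟨[], List.isChain_nil⟩).1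

@[simp] lemma wd_one : wd (1 : FreeProd q p) = [] := by simp [wd]

lemma wd_gen_mul (i : Label q p) (x : FreeProd q p) : wd (gen i * x) = consWord i (wd x) := by
  simp [wd, wordAction_gen, wordPerm]

lemma gen_star_mul (i : Label q p) : gen i.star * gen i = 1 := by
  rcases i with (i | i) | i
  · exact ((ofInt i).map_mul _ _).symm.trans (ofInt i).map_one
  · exact ((ofInt i).map_mul _ _).symm.trans (ofInt i).map_one
  · have h : Multiplicative.ofAdd (1 : ZMod 2) * Multiplicative.ofAdd (1 : ZMod 2) = 1 := by
      decide
    exact ((ofZMod i).map_mul _ _).symm.trans ((congrArg (ofZMod i) h).trans (ofZMod i).map_one)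

lemma gen_star (i : Label q p) : gen i.star = (gen i)⁻¹ :=
  eq_inv_of_mul_eq_one_left (gen_star_mul i)

lemma prod_consWord (i : Label q p) (l : List (Label q p)) :
    ((consWord i l).map gen).prod = gen i * (l.map gen).prod := by
  cases l with
  | nil => simp [consWord]
  | cons j t =>
    by_cases hj : j = i.star
    · subst hj; simp [consWord, gen_star]
    · simp [consWord, hj]

lemma gen_induction {P : FreeProd q p → Prop} (h1 : P 1)
    (hg : ∀ i x, P x → P (gen i * x)) (x : FreeProd q p) : P x := by
  -- The elements whose left multiplication preserves `P` form a submonoid. Labels come with their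
  -- inverses, so it contains every factor.
  let N : Submonoid (FreeProd q p) :=
    { carrier := {g | ∀ y, P y → P (g * y)}
      one_mem' := by simp
      mul_mem' := fun {a b} ha hb y hy => by rw [mul_assoc]; exact ha _ (hb _ hy) }
  have hgen : ∀ i, gen i ∈ N := fun i y hy => hg i y hy
  have key : ∀ g : FreeProd q p, g ∈ N := by
    intro g
    induction g using Monoid.CoprodI.induction_on with
    | one => exact N.one_mem
    | mul a b ha hb => exact N.mul_mem ha hb
    | of k m =>
      rcases k with i | i
      · let f : Multiplicative ℤ →* FreeProd q p := ofInt i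
        have hpos : ∀ n : ℕ, f (Multiplicative.ofAdd (n : ℤ)) ∈ N := by
          intro n
          have : Multiplicative.ofAdd (n : ℤ) = (Multiplicative.ofAdd (1 : ℤ)) ^ n := by
            rw [← ofAdd_nsmul]; simp
          rw [this, map_pow]
          exact N.pow_mem (hgen (.inl (.inl i))) n
        have hneg : ∀ n : ℕ, f (Multiplicative.ofAdd (-(n : ℤ))) ∈ N := by
          intro n
          have : Multiplicative.ofAdd (-(n : ℤ)) = (Multiplicative.ofAdd (-1 : ℤ)) ^ n := by
            rw [← ofAdd_nsmul]; simp
          rw [this, map_pow]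
          exact N.pow_mem (hgen (.inl (.inr i))) n
        change f m ∈ N
        obtain ⟨n, hn | hn⟩ := Int.eq_nat_or_neg (Multiplicative.toAdd (α := ℤ) m)
        · have := hpos n; rw [← hn] at this; exact this
        · have := hneg n; rw [← hn] at this; exact this
      · let f : Multiplicative (ZMod 2) →* FreeProd q p := ofZMod i
        have h2 : ∀ z : ZMod 2, f (Multiplicative.ofAdd z) ∈ N := by
          intro z
          have : z = 0 ∨ z = 1 := by revert z; decide
          rcases this with rfl | rfl
          · rw [ofAdd_zero, map_one]; exact N.one_mem
          · exact hgen (.inr i)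
        exact h2 m
  simpa using key x 1 h1

lemma prod_wd (x : FreeProd q p) : ((wd x).map gen).prod = x := by
  induction x using gen_induction with
  | h1 => simp
  | hg i x ih => rw [wd_gen_mul, prod_consWord, ih]

lemma wd_injective : Function.Injective (wd (q := q) (p := p)) := fun x y h => by
  rw [← prod_wd x, h, prod_wd]

/-- The edge from `x` to `g_i x` points away from the origin. -/
def Away (x : FreeProd q p) (i : Label q p) : Prop := wd (gen i * x) = i :: wd x

/-- The edge from `x` to `g_i x` points towards the origin. -/
def Toward (x : FreeProd q p) (i : Label q p) : Prop := wd x = i.star :: wd (gen i * x)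

lemma away_or_toward (x : FreeProd q p) (i : Label q p) : Away x i ∨ Toward x i := by
  unfold Away Toward
  rw [wd_gen_mul]
  cases h : wd x with
  | nil => simp [consWord]
  | cons j t =>
    by_cases hj : j = i.star
    · right; simp [consWord, hj]
    · left; simp [consWord, hj]

lemma not_away_iff {x : FreeProd q p} {i : Label q p} : ¬ Away x i ↔ Toward x i := by
  refine ⟨fun h => (away_or_toward x i).resolve_left h, fun h h' => ?_⟩
  have := congrArg List.length h
  rw [h'] at this
  simp at this
  omega

/-- Only the inverse of the first letter shortens a reduced word: a vertex of the tree has at most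
one neighbour closer to the origin. -/
lemma toward_unique {x : FreeProd q p} {i j : Label q p} (hi : Toward x i) (hj : Toward x j) :
    i = j := by
  unfold Toward at hi hj
  rw [hi] at hj
  have := congrArg Label.star (List.cons.inj hj).1
  simpa using this

lemma away_one (i : Label q p) : Away 1 i := by
  rw [Away, wd_gen_mul, wd_one, consWord]

lemma gen_mul_gen_star (i : Label q p) (x : FreeProd q p) : gen i.star * (gen i * x) = x := by
  simp [gen_star]

lemma Away.toward_star {x : FreeProd q p} {i : Label q p} (h : Away x i) :
    Toward (gen i * x) i.star := by
  unfold Toward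
  rw [gen_mul_gen_star, Label.star_star]; exact h

lemma Toward.away_star {x : FreeProd q p} {i : Label q p} (h : Toward x i) :
    Away (gen i * x) i.star := by
  unfold Away
  rw [gen_mul_gen_star]; exact h

lemma Away.next {x : FreeProd q p} {i j : Label q p} (h : Away x i) (hj : j ≠ i.star) :
    Away (gen i * x) j := by
  by_contra h'
  exact hj (toward_unique (not_away_iff.1 h') h.toward_star)

lemma Away.length {x : FreeProd q p} {i : Label q p} (h : Away x i) :
    (wd (gen i * x)).length = (wd x).length + 1 := by
  rw [h]; simp

end Words

/-! ### Operators on `ℂⁿ ⊗ ℓ²(X)` -/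

section Operators

variable {n X : Type*}

/-- The value of `f` at the point `x`, a vector of `ℂⁿ`. -/
def val (f : Amp n X) (x : X) : n → ℂ := fun k => f k x

@[simp] lemma val_add (f g : Amp n X) (x : X) : val (f + g) x = val f x + val g x := rfl

@[simp] lemma val_sub (f g : Amp n X) (x : X) : val (f - g) x = val f x - val g x := rfl

@[simp] lemma val_smul (c : ℂ) (f : Amp n X) (x : X) : val (c • f) x = c • val f x := rfl

@[simp] lemma val_zero (x : X) : val (0 : Amp n X) x = 0 := rfl

/-- The evaluation at `x` as a linear map. -/
def valLin (x : X) : Amp n X →ₗ[ℂ] (n → ℂ) where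
  toFun f := val f x
  map_add' _ _ := rfl
  map_smul' _ _ := rfl

lemma val_sum {ι : Type*} (s : Finset ι) (f : ι → Amp n X) (x : X) :
    val (∑ i ∈ s, f i) x = ∑ i ∈ s, val (f i) x := map_sum (valLin x) f s

lemma amp_ext {f g : Amp n X} (h : ∀ x, val f x = val g x) : f = g := by
  ext k x
  exact congrFun (h x) k

/-- Multiplication by the indicator function of a set. -/
noncomputable def indOp (s : Set X) : L2 X →L[ℂ] L2 X :=
  LinearMap.mkContinuous
    { toFun := fun g => ⟨s.indicator g, by
        refine memℓp_gen (((lp.memℓp g).summable (by norm_num)).of_nonneg_of_le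
          (fun x => by positivity) fun x => ?_)
        by_cases hx : x ∈ s <;> simp [hx]⟩
      map_add' := fun f g => by
        ext x
        exact congrFun (Set.indicator_add s f g) x
      map_smul' := fun c g => by
        ext x
        exact congrFun (Set.indicator_const_smul s c g) x } 1 (by
    intro g
    rw [one_mul]
    refine lp.norm_mono (by norm_num) fun x => ?_
    exact norm_indicator_le_norm_self _ _)

@[simp] lemma indOp_apply (s : Set X) (g : L2 X) (x : X) : indOp s g x = s.indicator g x := rfl

variable [Fintype n]

lemma val_tensorOp_permOp (m : Matrix n n ℂ) (σ : Equiv.Perm X) (f : Amp n X) (x : X) :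
    val (tensorOp m (permOp σ) f) x = m.mulVec (val f (σ x)) := by
  ext k
  simp only [val, tensorOp_apply, Matrix.mulVec, dotProduct]
  rw [lp.coeFn_sum]
  simp

lemma val_tensorOp_one (m : Matrix n n ℂ) (f : Amp n X) (x : X) :
    val (tensorOp m 1 f) x = m.mulVec (val f x) := by
  ext k
  simp only [val, tensorOp_apply, Matrix.mulVec, dotProduct]
  rw [lp.coeFn_sum]
  simp

lemma val_tensorOp_indOp [DecidableEq n] (s : Set X) (f : Amp n X) (x : X) :
    val (tensorOp 1 (indOp s) f) x = s.indicator (val f) x := by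
  ext k
  by_cases hx : x ∈ s <;>
  simp [val, tensorOp_apply, hx, Matrix.one_apply]

lemma tensorOp_mul (m m' : Matrix n n ℂ) (S T : L2 X →L[ℂ] L2 X) :
    tensorOp m S * tensorOp m' T = tensorOp (m * m') (S * T) := by
  ext1 f
  refine PiLp.ext fun k => ?_
  simp only [mul_apply_eq_comp, tensorOp_apply, map_sum, map_smul, Finset.smul_sum,
    Matrix.mul_apply, Finset.sum_smul, smul_smul]
  exact Finset.sum_comm

lemma tensorOp_add (m m' : Matrix n n ℂ) (T : L2 X →L[ℂ] L2 X) :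
    tensorOp (m + m') T = tensorOp m T + tensorOp m' T := by
  ext1 f
  refine PiLp.ext fun k => ?_
  simp [tensorOp_apply, add_smul, Finset.sum_add_distrib]

lemma tensorOp_smul (c : ℂ) (m : Matrix n n ℂ) (T : L2 X →L[ℂ] L2 X) :
    tensorOp (c • m) T = c • tensorOp m T := by
  ext1 f
  refine PiLp.ext fun k => ?_
  simp [tensorOp_apply, mul_smul, Finset.smul_sum]

lemma tensorOp_one_one [DecidableEq n] : tensorOp (X := X) (1 : Matrix n n ℂ) 1 = 1 := by
  ext1 f
  refine PiLp.ext fun k => ?_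
  simp [tensorOp_apply, Matrix.one_apply]

/-- The representation `m ↦ m ⊗ 1` of the matrix algebra. -/
noncomputable def matOp (n X : Type*) [Fintype n] [DecidableEq n] :
    Matrix n n ℂ →ₐ[ℂ] (Amp n X →L[ℂ] Amp n X) :=
  AlgHom.ofLinearMap
    { toFun := fun m => tensorOp m 1
      map_add' := fun m m' => tensorOp_add m m' 1
      map_smul' := fun c m => tensorOp_smul c m 1 }
    tensorOp_one_one (fun m m' => by simp [tensorOp_mul])

lemma matOp_apply [DecidableEq n] (m : Matrix n n ℂ) : matOp n X m = tensorOp m 1 := rfl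

lemma permOp_mul (σ τ : Equiv.Perm X) : permOp σ * permOp τ = permOp (τ * σ) := by
  ext f x
  rfl

lemma permOp_one : permOp (1 : Equiv.Perm X) = 1 := by
  ext f x
  rfl

/-- The vector `δ_y ⊗ v`. -/
noncomputable def deltaVec (y : X) : (n → ℂ) →ₗ[ℂ] Amp n X := by
  classical exact
  ∑ l, (LinearMap.proj l).smulRight (WithLp.toLp 2 (Pi.single l (lp.single 2 y (1 : ℂ))))

open Classical in
lemma val_deltaVec (y x : X) (v : n → ℂ) :
    val (deltaVec y v) x = if x = y then v else 0 := by
  ext k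
  simp only [deltaVec, val, LinearMap.sum_apply, LinearMap.smulRight_apply, LinearMap.proj_apply]
  simp only [WithLp.ofLp_sum, WithLp.ofLp_smul, Finset.sum_apply, Pi.smul_apply, lp.coeFn_sum,
    lp.coeFn_smul]
  rw [Finset.sum_eq_single k]
  · by_cases h : x = y
    · subst h; simp
    · simp [h]
  · intro l _ hl
    simp [Pi.single_eq_of_ne' hl]
  · simp

lemma val_apply_deltaVec (M : Amp n X →L[ℂ] Amp n X) (y x : X) (v : n → ℂ) :
    val (M (deltaVec y v)) x = (block M x y).mulVec v := by
  ext k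
  simp only [deltaVec, val, LinearMap.sum_apply, LinearMap.smulRight_apply, LinearMap.proj_apply,
    map_sum, map_smul]
  simp only [WithLp.ofLp_sum, WithLp.ofLp_smul, Finset.sum_apply, Pi.smul_apply, lp.coeFn_sum,
    lp.coeFn_smul, Matrix.mulVec, dotProduct, block, Matrix.of_apply, smul_eq_mul]
  exact Finset.sum_congr rfl fun l _ => mul_comm _ _

lemma block_ext {N : Matrix n n ℂ} {M : Matrix n n ℂ} (h : ∀ v, N.mulVec v = M.mulVec v) :
    N = M := by
  classical
  exact Matrix.toLin'.injective (LinearMap.ext fun v => by simpa using h v)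

end Operators

/-! ### The free resolvent on the tree and the relations between the weights. -/

section Free

variable {r q p : ℕ} {X : Type*} (a₀ : Matrix (Fin r) (Fin r) ℂ)
  (a : Label q p → Matrix (Fin r) (Fin r) ℂ)

lemma val_opA (σ : Label q p → Equiv.Perm X) (f : Amp (Fin r) X) (x : X) :
    val (opA a₀ a σ f) x = a₀.mulVec (val f x) + ∑ i, (a i).mulVec (val f (σ i x)) := by
  simp [opA, val_sum, val_tensorOp_one, val_tensorOp_permOp]

lemma val_freeA (f : Amp (Fin r) (FreeProd q p)) (x : FreeProd q p) :
    val (freeA a₀ a f) x = a₀.mulVec (val f x) + ∑ i, (a i).mulVec (val f (gen i * x)) :=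
  val_opA _ _ _ _ _

lemma mem_resolventSet_of_notMem_full {S : Set ℂ} {μ : ℂ} (h : μ ∉ full S) : μ ∉ S := by
  intro hμ
  refine h ?_
  simp only [full, Set.mem_compl_iff, Set.mem_ofPred_eq, not_not]
  rw [connectedComponentIn_eq_empty (by simpa using hμ)]
  exact Bornology.isBounded_empty

variable {a₀ a} {μ : ℂ}

lemma resolvent_mul (h : μ ∉ spectrum ℂ (freeA a₀ a)) :
    (algebraMap ℂ _ μ - freeA a₀ a) * freeG a₀ a μ = 1 :=
  Ring.mul_inverse_cancel _ (spectrum.notMem_iff.1 h)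

lemma mul_resolvent (h : μ ∉ spectrum ℂ (freeA a₀ a)) :
    freeG a₀ a μ * (algebraMap ℂ _ μ - freeA a₀ a) = 1 :=
  Ring.inverse_mul_cancel _ (spectrum.notMem_iff.1 h)

lemma val_sub_freeA (f : Amp (Fin r) (FreeProd q p)) (x : FreeProd q p) :
    val ((algebraMap ℂ _ μ - freeA a₀ a) f) x =
      (μ • 1 - a₀).mulVec (val f x) - ∑ i, (a i).mulVec (val f (gen i * x)) := by
  rw [sub_apply, val_sub, val_freeA]
  simp [Algebra.algebraMap_eq_smul_one, Matrix.sub_mulVec, Matrix.smul_mulVec, sub_sub]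

open Classical in
lemma freeG_equation (h : μ ∉ spectrum ℂ (freeA a₀ a)) (x y : FreeProd q p) :
    (μ • 1 - a₀) * block (freeG a₀ a μ) x y - ∑ i, a i * block (freeG a₀ a μ) (gen i * x) y =
      if x = y then 1 else 0 := by
  refine block_ext fun v => ?_
  have := congrArg (fun T => val (T (deltaVec y v)) x) (resolvent_mul h)
  simp only [mul_apply_eq_comp, val_sub_freeA, val_apply_deltaVec, one_apply_eq_self,
    val_deltaVec] at this
  simp only [Matrix.sub_mulVec, Matrix.sum_mulVec, ← Matrix.mulVec_mulVec]
  rw [← Matrix.sub_mulVec, this]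
  split_ifs <;> simp

/-- The right translation by `z`. -/
noncomputable def transOp (r : ℕ) (z : FreeProd q p) :
    Amp (Fin r) (FreeProd q p) →L[ℂ] Amp (Fin r) (FreeProd q p) :=
  tensorOp 1 (permOp (Equiv.mulRight z))

lemma val_transOp (z : FreeProd q p) (f : Amp (Fin r) (FreeProd q p)) (x : FreeProd q p) :
    val (transOp r z f) x = val f (x * z) := by
  simp [transOp, val_tensorOp_permOp]

/-- `A⋆` is built from left multiplications, which commute with right ones. Hence the blocks of `G`
depend on `x * y⁻¹` only. -/
lemma transOp_commute (z : FreeProd q p) : Commute (transOp r z) (freeA a₀ a) := by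
  refine ContinuousLinearMap.ext fun f => amp_ext fun x => ?_
  simp [mul_apply_eq_comp, val_transOp, val_freeA, mul_assoc]

lemma transOp_commute_freeG (z : FreeProd q p) : Commute (transOp r z) (freeG a₀ a μ) := by
  have : Commute (transOp r z) (algebraMap ℂ _ μ - freeA a₀ a) :=
    (Algebra.commute_algebraMap_right _ _).sub_right (transOp_commute z)
  unfold freeG resolvent
  by_cases hu : IsUnit (algebraMap ℂ _ μ - freeA a₀ a)
  · rw [Ring.inverse_of_isUnit hu]
    exact Commute.units_inv_right this
  · rw [Ring.inverse_non_unit _ hu]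
    exact Commute.zero_right _

lemma block_freeG_mul (x y z : FreeProd q p) :
    block (freeG a₀ a μ) (x * z) (y * z) = block (freeG a₀ a μ) x y := by
  classical
  refine block_ext fun v => ?_
  have h1 : transOp r z (deltaVec (y * z) v) = deltaVec y v := amp_ext fun w => by
    simp [val_transOp, val_deltaVec]
  have := congrArg (fun T => val (T (deltaVec (y * z) v)) x)
    (transOp_commute_freeG (a₀ := a₀) (a := a) (μ := μ) z).eq
  simpa only [mul_apply_eq_comp, val_transOp, h1, val_apply_deltaVec] using this

lemma block_freeG_self (x : FreeProd q p) : block (freeG a₀ a μ) x x = Goo a₀ a μ := by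
  simpa [Goo] using block_freeG_mul (a₀ := a₀) (a := a) (μ := μ) 1 1 x

/-- The words with suffix `wd (gen j * y)` form the branch of the tree behind `gen j * y`; the edge
from `y` is the only one that enters it. -/
lemma eq_of_suffix_gen_mul {y z : FreeProd q p} {i j : Label q p} (hy : Away y j)
    (h1 : ¬ wd (gen j * y) <:+ wd z) (h2 : wd (gen j * y) <:+ wd (gen i * z)) : z = y := by
  rcases away_or_toward z i with h | h
  · rw [h, List.suffix_cons_iff] at h2
    rcases h2 with h2 | h2
    · rw [hy] at h2
      exact wd_injective (List.cons.inj h2).2.symm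
    · exact absurd h2 h1
  · exact absurd (h2.trans (h ▸ List.suffix_cons _ _)) h1

lemma Goo_mul_hatA (h : IsUnit (Goo a₀ a μ)) (j : Label q p) :
    Goo a₀ a μ * hatA a₀ a μ j = block (freeG a₀ a μ) 1 (gen j) := by
  rw [hatA, ← mul_assoc, Matrix.mul_nonsing_inv _ ((Matrix.isUnit_iff_isUnit_det _).1 h), one_mul]

/-- The entries of the resolvent from the origin factorize along the edges that point away from
the origin. -/
lemma block_freeG_away (hμ : μ ∉ spectrum ℂ (freeA a₀ a)) (hG : IsUnit (Goo a₀ a μ))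
    {y : FreeProd q p} {j : Label q p} (hy : Away y j) :
    block (freeG a₀ a μ) 1 (gen j * y) = block (freeG a₀ a μ) 1 y * hatA a₀ a μ j := by
  classical
  refine block_ext fun v => ?_
  set C : Set (FreeProd q p) := {z | ¬ wd (gen j * y) <:+ wd z} with hC
  -- Both columns solve the homogeneous equation off `y` and `gen j * y`, and the definition of
  -- `hatA` makes their difference vanish at `y`.
  set D := freeG a₀ a μ (deltaVec (gen j * y) v) -
    freeG a₀ a μ (deltaVec y ((hatA a₀ a μ j).mulVec v)) with hD
  have hyC : y ∈ C := fun hh => by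
    have := hh.length_le
    rw [hy] at this
    simp at this
  have h1C : 1 ∈ C := fun hh => by
    rw [hy] at hh
    simp at hh
  have hDv : ∀ x, val D x = (block (freeG a₀ a μ) x (gen j * y)).mulVec v -
      (block (freeG a₀ a μ) x y).mulVec ((hatA a₀ a μ j).mulVec v) := fun x => by
    rw [hD, val_sub, val_apply_deltaVec, val_apply_deltaVec]
  have hDy : val D y = 0 := by
    have := block_freeG_mul (a₀ := a₀) (a := a) (μ := μ) 1 (gen j) y
    rw [one_mul] at this
    rw [hDv, this, block_freeG_self, Matrix.mulVec_mulVec, Goo_mul_hatA hG, sub_self]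
  have hAD : ∀ x, x ≠ y → x ≠ gen j * y →
      val ((algebraMap ℂ _ μ - freeA a₀ a) D) x = 0 := by
    intro x hx hx'
    rw [hD, map_sub, ← mul_apply_eq_comp, ← mul_apply_eq_comp,
      resolvent_mul hμ, val_sub, one_apply_eq_self, one_apply_eq_self, val_deltaVec, val_deltaVec,
        if_neg hx,
      if_neg hx', sub_zero]
  -- Cutting off the branch creates an error at most at `y`: this is the only vertex of `C` adjacent
  -- to the branch, and `D` vanishes there.
  set D' := tensorOp 1 (indOp C) D with hD'
  have hD'v : ∀ x, val D' x = C.indicator (val D) x := fun x => val_tensorOp_indOp _ _ _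
  have hAD' : ∀ x, x ≠ y → val ((algebraMap ℂ _ μ - freeA a₀ a) D') x = 0 := by
    intro x hx
    by_cases hxC : x ∈ C
    · have hnb : ∀ i, gen i * x ∈ C := fun i => by
        by_contra hi
        exact hx (eq_of_suffix_gen_mul hy hxC (not_not.1 hi))
      have hx' : x ≠ gen j * y := by
        rintro rfl
        exact hxC List.suffix_rfl
      rw [← hAD x hx hx', val_sub_freeA, val_sub_freeA, hD'v, Set.indicator_of_mem hxC]
      simp only [hD'v, Set.indicator_of_mem (hnb _)]
    · have hz : val D' x = 0 := by rw [hD'v, Set.indicator_of_notMem hxC]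
      have hnb : ∀ i, val D' (gen i * x) = 0 := fun i => by
        rw [hD'v]
        by_cases hi : gen i * x ∈ C
        · have : gen i * x = y := eq_of_suffix_gen_mul (i := i.star) hy hi (by
            rw [gen_mul_gen_star]
            exact not_not.1 hxC)
          rw [this, Set.indicator_of_mem hyC, hDy]
        · rw [Set.indicator_of_notMem hi]
      rw [val_sub_freeA, hz]
      simp [hnb]
  set m := val ((algebraMap ℂ _ μ - freeA a₀ a) D') y with hm
  have hDm : (algebraMap ℂ _ μ - freeA a₀ a) D' = deltaVec y m := amp_ext fun x => by
    rw [val_deltaVec]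
    split_ifs with hx
    · rw [hx]
    · exact hAD' x hx
  have hGD : D' = freeG a₀ a μ (deltaVec y m) := by
    rw [← hDm, ← mul_apply_eq_comp, mul_resolvent hμ, one_apply_eq_self]
  -- `D'` is now a column of `G` at `y`; its value at `y` is both `G_oo m` and `0`.
  have hm0 : m = 0 := by
    have h0 : (Goo a₀ a μ).mulVec m = 0 := by
      rw [← block_freeG_self y, ← val_apply_deltaVec, ← hGD, hD'v, Set.indicator_of_mem hyC, hDy]
    exact Matrix.mulVec_injective_of_isUnit hG (h0.trans (Matrix.mulVec_zero _).symm)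
  have h1 : val D 1 = 0 := by
    have := hD'v 1
    rw [Set.indicator_of_mem h1C, hGD, hm0, map_zero, map_zero, val_zero] at this
    exact this.symm
  rw [hDv, sub_eq_zero] at h1
  rw [h1, Matrix.mulVec_mulVec]

/-- The resolvent equation at `(o, o)`, where right translation gives `G_{g_i,o} = G_{o,g_{i*}}`. -/
lemma hatA_relation_one (hμ : μ ∉ spectrum ℂ (freeA a₀ a)) (hG : IsUnit (Goo a₀ a μ)) :
    (μ • 1 - a₀) * Goo a₀ a μ - ∑ i, a i * (Goo a₀ a μ * hatA a₀ a μ i.star) = 1 := by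
  have h := freeG_equation hμ (1 : FreeProd q p) 1
  rw [if_pos rfl] at h
  refine Eq.trans ?_ h
  refine congrArg₂ (fun u v => u - v) rfl (Finset.sum_congr rfl fun i _ => ?_)
  have := block_freeG_mul (a₀ := a₀) (a := a) (μ := μ) 1 (gen i.star) (gen i)
  rw [Goo_mul_hatA hG, ← this, gen_star_mul, one_mul, mul_one]

/-- The resolvent equation at `(o, g_j)` is compared with the one at `(o, o)` times `â_j`. By
multiplicativity the neighbour terms agree except for `i = j`. -/
lemma hatA_relation_two (hμ : μ ∉ spectrum ℂ (freeA a₀ a)) (hG : IsUnit (Goo a₀ a μ))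
    (j : Label q p) :
    a j * Goo a₀ a μ * (1 - hatA a₀ a μ j.star * hatA a₀ a μ j) = hatA a₀ a μ j := by
  have h := freeG_equation hμ (1 : FreeProd q p) (gen j)
  have hne : (1 : FreeProd q p) ≠ gen j := fun h => by
    have := away_one (q := q) (p := p) j
    rw [Away, mul_one, ← h] at this
    simp at this
  have h1 := congrArg (fun m => m * hatA a₀ a μ j) (hatA_relation_one hμ hG)
  rw [if_neg hne, ← Goo_mul_hatA hG] at h
  have h2 : ∀ i, a i * block (freeG a₀ a μ) (gen i * 1) (gen j) =
      a i * (Goo a₀ a μ * hatA a₀ a μ i.star * hatA a₀ a μ j) + if i = j then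
        a j * Goo a₀ a μ * (1 - hatA a₀ a μ j.star * hatA a₀ a μ j) else 0 := by
    intro i
    by_cases hij : i = j
    · subst hij
      rw [mul_one, block_freeG_self, if_pos rfl]
      noncomm_ring
    · rw [if_neg hij, add_zero, mul_one]
      have h3 := block_freeG_mul (a₀ := a₀) (a := a) (μ := μ) 1 (gen j * gen i.star) (gen i)
      rw [mul_assoc, gen_star_mul, mul_one, one_mul] at h3
      have h4 : Away (gen i.star) j := by
        have := (away_one (q := q) (p := p) i.star).next (j := j) (by simpa using Ne.symm hij)
        rwa [mul_one] at this
      rw [h3, block_freeG_away hμ hG h4, Goo_mul_hatA hG]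
  simp only [h2, Finset.sum_add_distrib, Finset.sum_ite_eq', Finset.mem_univ, if_true] at h
  rw [sub_add_eq_sub_sub, sub_eq_zero] at h
  rw [← h]
  simpa only [sub_mul _ _ (hatA a₀ a μ j), Finset.sum_mul, one_mul, mul_assoc] using h1

end Free

/-! ### Spectral radius and powers -/

section SpectralRadius

open Filter Topology

variable {A : Type*} [NormedRing A] [NormedAlgebra ℂ A] [CompleteSpace A]

/-- The strict inequality survives the supremum because it is attained; for an empty spectrum the
supremum is `0`. -/
lemma spectralRadius_lt_one_of_forall {a : A} (h : ∀ z ∈ spectrum ℂ a, ‖z‖ < 1) :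
    spectralRadius ℂ a < 1 := by
  rcases (spectrum ℂ a).eq_empty_or_nonempty with h0 | h0
  · simp [spectralRadius, h0]
  · obtain ⟨z, hz, hz'⟩ := spectrum.exists_nnnorm_eq_spectralRadius_of_nonempty h0
    rw [← hz']
    exact_mod_cast h z hz

lemma spectralRadius_lt_one_of_norm_pow_lt_one {a : A} {n : ℕ} (h : ‖a ^ n‖ < 1) :
    spectralRadius ℂ a < 1 := by
  refine spectralRadius_lt_one_of_forall fun z hz => ?_
  by_contra! hz1
  have h1 : 1 ≤ ‖z ^ n‖ := by rw [norm_pow]; exact one_le_pow₀ hz1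
  have hz0 : z ^ n ≠ 0 := fun h0 => by rw [h0, norm_zero] at h1; linarith
  refine (spectrum.pow_mem_pow a n hz) ?_
  have : algebraMap ℂ A (z ^ n) - a ^ n = z ^ n • (1 - (z ^ n)⁻¹ • a ^ n) := by
    rw [smul_sub, smul_smul, mul_inv_cancel₀ hz0, one_smul, Algebra.algebraMap_eq_smul_one]
  rw [spectrum.mem_resolventSet_iff, this]
  have hu : IsUnit (1 - (z ^ n)⁻¹ • a ^ n) := by
    refine isUnit_one_sub_of_norm_lt_one ?_
    rw [norm_smul, norm_inv]
    exact (mul_le_of_le_one_left (norm_nonneg _) (inv_le_one_of_one_le₀ h1)).trans_lt h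
  exact (IsUnit.smul (Units.mk0 _ hz0) hu)

/-- By Gelfand's formula the norms are eventually below `s ^ n` with `s < 1`. -/
lemma tendsto_pow_of_spectralRadius_lt_one {a : A} (h : spectralRadius ℂ a < 1) :
    Tendsto (fun n : ℕ => ‖a ^ n‖) atTop (𝓝 0) := by
  obtain ⟨s, hs, hs1⟩ := ENNReal.lt_iff_exists_nnreal_btwn.1 h
  have hs1' : s < 1 := by exact_mod_cast hs1
  have h1 := (spectrum.pow_nnnorm_pow_one_div_tendsto_nhds_spectralRadius a).eventually
    (gt_mem_nhds hs)
  refine squeeze_zero' (Eventually.of_forall fun n => norm_nonneg _) ?_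
    (tendsto_pow_atTop_nhds_zero_of_lt_one s.2 (by exact_mod_cast hs1'))
  filter_upwards [h1, eventually_ne_atTop 0] with n hn hn0
  have hn' : (n : ℝ) ≠ 0 := by exact_mod_cast hn0
  have := ENNReal.rpow_le_rpow hn.le (Nat.cast_nonneg' n : (0 : ℝ) ≤ n)
  rw [← ENNReal.rpow_mul, one_div, inv_mul_cancel₀ hn', ENNReal.rpow_one, ENNReal.rpow_natCast]
    at this
  exact_mod_cast this

/-- A criterion for the powers of a block triangular element to become small. -/
lemma exists_norm_pow_lt_one_of_triangular {R : Type*} [NormedRing R] {P B : R} {n : ℕ}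
    (hPB : P * B * (1 - P) = 0) (hP : P * P = P) (h1 : ‖P * B ^ n‖ ≤ 1 / 2)
    (h2 : ‖B ^ n * (1 - P)‖ ≤ 1 / 2) : ∃ m, ‖B ^ m‖ < 1 := by
  have hQQ : (1 - P) * (1 - P) = 1 - P := by
    rw [sub_mul, mul_sub, mul_sub, hP]; simp
  have hBQ : B * (1 - P) = (1 - P) * B * (1 - P) := by
    rw [sub_mul 1 P B, sub_mul _ _ (1 - P), hPB, one_mul, sub_zero]
  have hBn : ∀ k : ℕ, B ^ k * (1 - P) = (1 - P) * (B ^ k * (1 - P)) := by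
    intro k
    induction k with
    | zero => rw [pow_zero, one_mul, hQQ]
    | succ k ih =>
      rw [pow_succ', mul_assoc, ih, ← mul_assoc B, hBQ]
      simp only [mul_assoc]
      rw [← mul_assoc (1 - P) (1 - P), hQQ]
  set C := B ^ n with hC
  have hCQ : ∀ k : ℕ, ‖C ^ (k + 1) * (1 - P)‖ ≤ (1 / 2) ^ (k + 1) := by
    intro k
    induction k with
    | zero => simpa using h2
    | succ k ih =>
      have : C ^ (k + 1 + 1) * (1 - P) = (C ^ (k + 1) * (1 - P)) * (C * (1 - P)) := by
        rw [pow_succ C (k + 1), mul_assoc, mul_assoc, ← hBn n]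
      rw [this, pow_succ (1 / 2 : ℝ) (k + 1)]
      exact (norm_mul_le _ _).trans (mul_le_mul ih h2 (norm_nonneg _) (by positivity))
  -- Splitting the last factor as `P * C + (1 - P) * C` gives `x_{k+1} ≤ x_k / 2 + ‖C‖ / 2 ^ (k +
  -- 1)` for the norms `x_k`: the off-diagonal block costs only a factor linear in `k`.
  have hCk : ∀ k : ℕ, ‖C ^ (k + 1)‖ ≤ 2 * ‖C‖ * ((k + 1 : ℕ) * (1 / 2) ^ (k + 1)) := by
    intro k
    induction k with
    | zero => simp; linarith
    | succ k ih =>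
      have : C ^ (k + 1 + 1) = C ^ (k + 1) * (P * C) + C ^ (k + 1) * (1 - P) * C := by
        rw [pow_succ C (k + 1)]; noncomm_ring
      rw [this]
      have e1 : ‖C ^ (k + 1) * (P * C)‖ ≤ 2 * ‖C‖ * ((k + 1 : ℕ) * (1 / 2) ^ (k + 1)) * (1 / 2) :=
        (norm_mul_le _ _).trans (mul_le_mul ih h1 (norm_nonneg _) (by positivity))
      have e2 : ‖C ^ (k + 1) * (1 - P) * C‖ ≤ (1 / 2) ^ (k + 1) * ‖C‖ :=
        (norm_mul_le _ _).trans (mul_le_mul_of_nonneg_right (hCQ k) (norm_nonneg _))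
      refine (norm_add_le _ _).trans ((add_le_add e1 e2).trans (le_of_eq ?_))
      push_cast
      ring
  have hlim : Tendsto (fun k : ℕ => 2 * ‖C‖ * ((k : ℕ) * (1 / 2 : ℝ) ^ k)) atTop (𝓝 0) := by
    simpa using (tendsto_self_mul_const_pow_of_lt_one (r := (1 / 2 : ℝ)) (by norm_num)
      (by norm_num)).const_mul (2 * ‖C‖)
  obtain ⟨k, hk⟩ := (((tendsto_add_atTop_iff_nat 1).2 hlim).eventually
    (gt_mem_nhds one_pos)).exists
  refine ⟨n * (k + 1), ?_⟩
  rw [pow_mul]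
  exact (hCk k).trans_lt hk

end SpectralRadius

/-! ### Sums of squares -/

section Squares

open scoped NNReal

variable {r : ℕ}

/-- The square of the Euclidean norm. -/
noncomputable def nsq (v : Fin r → ℂ) : ℝ≥0 := ∑ k, ‖v k‖₊ ^ 2

/-- The square of the Frobenius norm. -/
noncomputable def frob (M : Matrix (Fin r) (Fin r) ℂ) : ℝ≥0 := ∑ k, nsq (M k)

@[simp] lemma nsq_zero : nsq (0 : Fin r → ℂ) = 0 := by simp [nsq]

lemma nnnorm_sum_mul_sq_le {ι : Type*} (s : Finset ι) (f g : ι → ℂ) :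
    ‖∑ i ∈ s, f i * g i‖₊ ^ 2 ≤ (∑ i ∈ s, ‖f i‖₊ ^ 2) * ∑ i ∈ s, ‖g i‖₊ ^ 2 := by
  refine le_trans (pow_le_pow_left₀ (by positivity) (nnnorm_sum_le _ _) 2) ?_
  simp only [nnnorm_mul]
  exact Finset.sum_mul_sq_le_sq_mul_sq _ _ _

lemma nsq_mulVec_le (M : Matrix (Fin r) (Fin r) ℂ) (v : Fin r → ℂ) :
    nsq (M.mulVec v) ≤ frob M * nsq v := by
  rw [frob, Finset.sum_mul]
  exact Finset.sum_le_sum fun k _ => nnnorm_sum_mul_sq_le _ _ _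

lemma frob_eq_sum_col (M : Matrix (Fin r) (Fin r) ℂ) : frob M = ∑ l, nsq (M.col l) := by
  simp only [frob, nsq, Matrix.col]
  exact Finset.sum_comm

lemma frob_mul_le (M N : Matrix (Fin r) (Fin r) ℂ) : frob (M * N) ≤ frob M * frob N := by
  rw [frob_eq_sum_col, frob_eq_sum_col N, Finset.mul_sum]
  exact Finset.sum_le_sum fun l _ => nsq_mulVec_le M (N.col l)

/-- The triangle inequality followed by Cauchy–Schwarz for `√c_j` and `√d_j`. -/
lemma nsq_sum_le {ι : Type*} (s : Finset ι) (u : ι → Fin r → ℂ) (c d : ι → ℝ≥0)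
    (h : ∀ j ∈ s, nsq (u j) ≤ c j * d j) :
    nsq (∑ j ∈ s, u j) ≤ (∑ j ∈ s, c j) * ∑ j ∈ s, d j := by
  have key : ∀ v : Fin r → ℂ, nsq v = ‖WithLp.toLp 2 v‖₊ ^ 2 := fun v => by
    refine NNReal.coe_injective ?_
    push_cast
    rw [EuclideanSpace.norm_sq_eq, nsq]
    push_cast
    rfl
  rw [key, WithLp.toLp_sum]
  refine (pow_le_pow_left₀ (by positivity) (nnnorm_sum_le _ _) 2).trans ?_
  refine Finset.sum_sq_le_sum_mul_sum_of_sq_le_mul s (fun _ _ => by positivity)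
    (fun _ _ => by positivity) fun j hj => ?_
  rw [← key]
  exact h j hj

/-- Squared norms are taken in `ℝ≥0∞`, where sums can be interchanged without summability
conditions. -/
lemma enorm_sq_amp {n X : Type*} [Fintype n] (f : Amp n X) :
    ((‖f‖₊ ^ 2 : ℝ≥0) : ℝ≥0∞) = ∑' x, ∑ k, ((‖f k x‖₊ ^ 2 : ℝ≥0) : ℝ≥0∞) := by
  rw [Summable.tsum_finsetSum fun _ _ => ENNReal.summable]
  have h1 : ‖f‖₊ ^ 2 = ∑ k, ‖f k‖₊ ^ 2 := by
    refine NNReal.coe_injective ?_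
    push_cast
    rw [PiLp.norm_sq_eq_of_L2]
  rw [h1]
  push_cast
  refine Finset.sum_congr rfl fun k _ => ?_
  have h2 := lp.norm_rpow_eq_tsum (p := 2) (by norm_num) (f k)
  have h3 := (lp.memℓp (f k)).summable (p := 2) (by norm_num)
  norm_num at h2 h3
  have h4 : Summable fun x => ‖f k x‖₊ ^ 2 := by
    rw [← NNReal.summable_coe]; push_cast; exact h3
  have h5 : ‖f k‖₊ ^ 2 = ∑' x, ‖f k x‖₊ ^ 2 := by
    refine NNReal.coe_injective ?_
    push_cast
    exact h2
  have := ENNReal.coe_tsum h4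
  rw [← h5] at this
  exact_mod_cast this

end Squares

/-! ### The non-backtracking operator of the free product -/

section NonBacktrackingOperator

open scoped NNReal
open Filter Topology

variable {r q p : ℕ} {X : Type*}

/-- The value of `f` at the edge with label `i` that starts at `x`. -/
def ev (f : Amp (Fin r × Label q p) X) (x : X) (i : Label q p) : Fin r → ℂ := fun k => f (k, i) x

lemma edge_ext {f g : Amp (Fin r × Label q p) X} (h : ∀ x i, ev f x i = ev g x i) : f = g := by
  ext ⟨k, i⟩ x
  exact congrFun (h x i) k

lemma tensorOp_single_apply (b : Matrix (Fin r) (Fin r) ℂ) (i' j' : Label q p)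
    (T : L2 X →L[ℂ] L2 X) (f : Amp (Fin r × Label q p) X) (k : Fin r) (i : Label q p) :
    tensorOp (Matrix.kroneckerMap (· * ·) b (Matrix.single i' j' (1 : ℂ))) T f (k, i) =
      if i' = i then ∑ l, b k l • T (f (l, j')) else 0 := by
  rw [tensorOp_apply, Fintype.sum_prod_type]
  simp only [Matrix.kroneckerMap_apply, Matrix.single_apply]
  by_cases h : i' = i
  · simp [h]
  · simp [h]

lemma opB_apply (b : Label q p → Matrix (Fin r) (Fin r) ℂ) (σ : Label q p → Equiv.Perm X)
    (f : Amp (Fin r × Label q p) X) (k : Fin r) (i : Label q p) :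
    opB b σ f (k, i) =
      ∑ j, if j ≠ i.star then ∑ l, b j k l • permOp (σ i) (f (l, j)) else 0 := by
  simp only [opB, sum_apply, WithLp.ofLp_sum, Finset.sum_apply]
  rw [Finset.sum_eq_single i]
  · refine Finset.sum_congr rfl fun j _ => ?_
    split_ifs
    · rw [tensorOp_single_apply, if_pos rfl]
    · rfl
  · intro i' _ hi'
    refine Finset.sum_eq_zero fun j _ => ?_
    split_ifs
    · rw [tensorOp_single_apply, if_neg hi']
    · rfl
  · simp

lemma ev_opB (b : Label q p → Matrix (Fin r) (Fin r) ℂ) (σ : Label q p → Equiv.Perm X)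
    (f : Amp (Fin r × Label q p) X) (x : X) (i : Label q p) :
    ev (opB b σ f) x i = ∑ j, if j ≠ i.star then (b j).mulVec (ev f (σ i x) j) else 0 := by
  ext k
  rw [ev, opB_apply, lp.coeFn_sum, Finset.sum_apply, Finset.sum_apply]
  refine Finset.sum_congr rfl fun j _ => ?_
  split_ifs
  · rw [lp.coeFn_sum]
    simp [Matrix.mulVec, dotProduct, ev]
  · rfl

lemma ev_freeB (b : Label q p → Matrix (Fin r) (Fin r) ℂ)
    (f : Amp (Fin r × Label q p) (FreeProd q p)) (x : FreeProd q p) (i : Label q p) :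
    ev (freeB b f) x i = ∑ j, if j ≠ i.star then (b j).mulVec (ev f (gen i * x) j) else 0 :=
  ev_opB _ _ _ _ _

lemma enorm_sq_edge (f : Amp (Fin r × Label q p) X) :
    ((‖f‖₊ ^ 2 : ℝ≥0) : ℝ≥0∞) = ∑' x, ∑ i, (nsq (ev f x i) : ℝ≥0∞) := by
  rw [enorm_sq_amp]
  refine tsum_congr fun x => ?_
  rw [Fintype.sum_prod_type, Finset.sum_comm]
  refine Finset.sum_congr rfl fun i _ => ?_
  rw [nsq]
  push_cast
  rfl

open Classical in
/-- The projection onto the edges that point away from the origin. -/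
noncomputable def awayProj (r q p : ℕ) :
    Amp (Fin r × Label q p) (FreeProd q p) →L[ℂ] Amp (Fin r × Label q p) (FreeProd q p) :=
  ∑ i, tensorOp (Matrix.kroneckerMap (· * ·) 1 (Matrix.single i i (1 : ℂ)))
    (indOp {x | Away x i})

open Classical in
lemma ev_awayProj (f : Amp (Fin r × Label q p) (FreeProd q p)) (x : FreeProd q p)
    (i : Label q p) : ev (awayProj r q p f) x i = if Away x i then ev f x i else 0 := by
  ext k
  simp only [ev, awayProj, sum_apply, WithLp.ofLp_sum, Finset.sum_apply, tensorOp_single_apply]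
  simp only [Finset.sum_ite_eq', Finset.mem_univ, if_true, Matrix.one_apply, ite_smul, one_smul,
    zero_smul, Finset.sum_ite_eq, indOp_apply]
  split_ifs with h <;> simp [h, ev]

/-- The sum of the squares of the norms of the products of `n` further weights along the
non-backtracking paths that continue the label `i`, starting from the matrix `M`. -/
noncomputable def pathWeight (b : Label q p → Matrix (Fin r) (Fin r) ℂ) :
    ℕ → Label q p → Matrix (Fin r) (Fin r) ℂ → ℝ≥0
  | 0, _, M => frob M
  | n + 1, i, M => ∑ j, if j ≠ i.star then pathWeight b n j (M * b j) else 0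

/-- The sum of `F` over the edges reached from an edge by `n` non-backtracking steps. -/
noncomputable def pathSum (F : FreeProd q p → Label q p → ℝ≥0) :
    ℕ → FreeProd q p → Label q p → ℝ≥0
  | 0, x, i => F x i
  | n + 1, x, i => ∑ j, if j ≠ i.star then pathSum F n (gen i * x) j else 0

/-- The weighted sum of `F` over the edges reached from an edge by `n` non-backtracking steps. -/
noncomputable def pathWeightSum (b : Label q p → Matrix (Fin r) (Fin r) ℂ)
    (F : FreeProd q p → Label q p → ℝ≥0) :
    ℕ → FreeProd q p → Label q p → Matrix (Fin r) (Fin r) ℂ → ℝ≥0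
  | 0, x, i, M => frob M * F x i
  | n + 1, x, i, M =>
    ∑ j, if j ≠ i.star then pathWeightSum b F n (gen i * x) j (M * b j) else 0

variable (b : Label q p → Matrix (Fin r) (Fin r) ℂ)

lemma mulVec_ev_freeB_pow_succ (f : Amp (Fin r × Label q p) (FreeProd q p)) (n : ℕ)
    (x : FreeProd q p) (i : Label q p) (M : Matrix (Fin r) (Fin r) ℂ) :
    M.mulVec (ev ((freeB b ^ (n + 1)) f) x i) =
      ∑ j, if j ≠ i.star then (M * b j).mulVec (ev ((freeB b ^ n) f) (gen i * x) j) else 0 := by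
  rw [pow_succ', mul_apply_eq_comp, ev_freeB, Matrix.mulVec_sum]
  refine Finset.sum_congr rfl fun j _ => ?_
  split_ifs
  · rw [Matrix.mulVec_mulVec]
  · rw [Matrix.mulVec_zero]

/-- Cauchy–Schwarz along non-backtracking paths separates the weights from the values of `f` at the
final edges. In the induction `M` carries the product of the weights already met. -/
lemma nsq_freeB_pow_le (f : Amp (Fin r × Label q p) (FreeProd q p)) (n : ℕ)
    (x : FreeProd q p) (i : Label q p) (M : Matrix (Fin r) (Fin r) ℂ) :
    nsq (M.mulVec (ev ((freeB b ^ n) f) x i)) ≤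
      pathWeight b n i M * pathSum (fun x i => nsq (ev f x i)) n x i := by
  induction n generalizing x i M with
  | zero => exact nsq_mulVec_le _ _
  | succ n ih =>
    rw [mulVec_ev_freeB_pow_succ, pathWeight, pathSum]
    refine nsq_sum_le _ _ _ _ fun j _ => ?_
    split_ifs
    · exact ih _ _ _
    · simp

/-- Non-backtracking continuations of an outward edge are outward, so `f` is only evaluated where it
vanishes. -/
lemma freeB_pow_toward {f : Amp (Fin r × Label q p) (FreeProd q p)}
    (hf : ∀ x i, Away x i → ev f x i = 0) (n : ℕ) (x : FreeProd q p) (i : Label q p)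
    (h : Away x i) : ev ((freeB b ^ n) f) x i = 0 := by
  induction n generalizing x i with
  | zero => exact hf x i h
  | succ n ih =>
    rw [pow_succ', mul_apply_eq_comp, ev_freeB]
    refine Finset.sum_eq_zero fun j _ => ?_
    split_ifs with hj
    · rw [ih _ _ (h.next hj), Matrix.mulVec_zero]
    · rfl

lemma nsq_sum_le_of_unique {ι : Type*} [Fintype ι] {u : ι → Fin r → ℂ}
    (h : ∀ i j, u i ≠ 0 → u j ≠ 0 → i = j) : nsq (∑ j, u j) ≤ ∑ j, nsq (u j) := by
  by_cases h0 : ∃ i, u i ≠ 0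
  · obtain ⟨i, hi⟩ := h0
    rw [Finset.sum_eq_single i (fun j _ hj => by_contra fun hu => hj (h j i hu hi)) (by simp)]
    exact Finset.single_le_sum (f := fun j => nsq (u j)) (fun _ _ => by positivity)
      (Finset.mem_univ i)
  · push Not at h0
    simp [h0]

/-- Since an edge has at most one inward continuation, at most one term of each sum survives. No
Cauchy–Schwarz is needed and every weight stays with its final edge. -/
lemma nsq_freeB_pow_le_of_toward {f : Amp (Fin r × Label q p) (FreeProd q p)}
    (hf : ∀ x i, Away x i → ev f x i = 0) (n : ℕ)
    (x : FreeProd q p) (i : Label q p) (M : Matrix (Fin r) (Fin r) ℂ) :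
    nsq (M.mulVec (ev ((freeB b ^ n) f) x i)) ≤
      pathWeightSum b (fun x i => nsq (ev f x i)) n x i M := by
  induction n generalizing x i M with
  | zero => exact nsq_mulVec_le _ _
  | succ n ih =>
    rw [mulVec_ev_freeB_pow_succ, pathWeightSum]
    refine (nsq_sum_le_of_unique fun j k hj hk => ?_).trans (Finset.sum_le_sum fun j _ => ?_)
    · have key : ∀ j, (if j ≠ i.star then
          (M * b j).mulVec (ev ((freeB b ^ n) f) (gen i * x) j) else 0) ≠ 0 →
          Toward (gen i * x) j := fun j hj => by
        rw [← not_away_iff]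
        intro ha
        rw [freeB_pow_toward b hf n _ _ ha] at hj
        simp at hj
      exact toward_unique (key j hj) (key k hk)
    · split_ifs
      · exact ih _ _ _
      · simp

/-- When the starting point is summed over, the translation by `gen i` drops out at each step, so
every path contributes at most its weight times the total of `F`. -/
lemma tsum_pathWeightSum_le (F : FreeProd q p → Label q p → ℝ≥0) (n : ℕ) (i : Label q p)
    (M : Matrix (Fin r) (Fin r) ℂ) :
    ∑' x, (pathWeightSum b F n x i M : ℝ≥0∞) ≤
      pathWeight b n i M * ∑' x, ∑ i, (F x i : ℝ≥0∞) := by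
  induction n generalizing i M with
  | zero =>
    simp only [pathWeightSum, pathWeight, ENNReal.coe_mul]
    rw [ENNReal.tsum_mul_left]
    gcongr with x
    exact Finset.single_le_sum (f := fun i => (F x i : ℝ≥0∞)) (fun _ _ => by positivity)
      (Finset.mem_univ i)
  | succ n ih =>
    simp only [pathWeightSum, pathWeight]
    push_cast
    rw [Summable.tsum_finsetSum fun _ _ => ENNReal.summable, Finset.sum_mul]
    refine Finset.sum_le_sum fun j _ => ?_
    split_ifs
    · refine le_trans (le_of_eq ?_) (ih j (M * b j))
      exact (Equiv.mulLeft (gen i)).tsum_eq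
        (fun y => (pathWeightSum b F n y j (M * b j) : ℝ≥0∞))
    · simp

-- An outward edge at `y` has at most one outward predecessor, the edge that enters `y` from its
-- neighbour closer to the origin; so no term is counted twice.
open Classical in
lemma tsum_away_step (H : FreeProd q p → Label q p → ℝ≥0∞) :
    ∑' x, ∑ i, (if Away x i then ∑ j, if j ≠ i.star then H (gen i * x) j else 0 else 0) ≤
      ∑' y, ∑ j, if Away y j then H y j else 0 := by
  have h1 : ∀ i : Label q p,
      ∑' x, (if Away x i then ∑ j, if j ≠ i.star then H (gen i * x) j else 0 else 0) =
      ∑' y, ∑ j, if Toward y i.star ∧ j ≠ i.star then H y j else 0 := fun i => by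
    refine Eq.trans ?_ ((Equiv.mulLeft (gen i)).tsum_eq
      fun y => ∑ j, if Toward y i.star ∧ j ≠ i.star then H y j else 0)
    refine tsum_congr fun x => ?_
    have : Toward (gen i * x) i.star ↔ Away x i :=
      ⟨fun h => by simpa [gen_mul_gen_star] using h.away_star, fun h => h.toward_star⟩
    simp only [Equiv.coe_mulLeft, this]
    by_cases h : Away x i
    · simp only [h, true_and, if_true]
    · simp only [h, false_and, if_false, Finset.sum_const_zero]
  rw [Summable.tsum_finsetSum fun _ _ => ENNReal.summable]
  simp only [h1]
  rw [← Summable.tsum_finsetSum fun _ _ => ENNReal.summable]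
  refine ENNReal.tsum_le_tsum fun y => ?_
  rw [Finset.sum_comm]
  refine Finset.sum_le_sum fun j _ => ?_
  by_cases h0 : ∃ i : Label q p, Toward y i.star ∧ j ≠ i.star
  · obtain ⟨i, hi⟩ := h0
    have haw : Away y j := by
      by_contra hn
      exact hi.2 (toward_unique (not_away_iff.1 hn) hi.1)
    rw [Finset.sum_eq_single i, if_pos hi, if_pos haw]
    · intro i' _ hi'
      refine if_neg fun h => hi' ?_
      simpa using congrArg Label.star (toward_unique h.1 hi.1)
    · simp
  · push Not at h0
    rw [Finset.sum_eq_zero fun i _ => if_neg fun h => h.2 (h0 i h.1)]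
    exact zero_le

open Classical in
lemma tsum_away_pathSum_le (F : FreeProd q p → Label q p → ℝ≥0) (n : ℕ) :
    ∑' x, ∑ i, (if Away x i then (pathSum F n x i : ℝ≥0∞) else 0) ≤
      ∑' x, ∑ i, if Away x i then (F x i : ℝ≥0∞) else 0 := by
  induction n with
  | zero => exact le_rfl
  | succ n ih =>
    refine le_trans (le_of_eq ?_) ((tsum_away_step fun x i => (pathSum F n x i : ℝ≥0∞)).trans ih)
    simp only [pathSum, ENNReal.ofNNReal_finsetSum, apply_ite ENNReal.ofNNReal, ENNReal.coe_zero]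

open Classical in
lemma tsum_level_pathSum_le (F : FreeProd q p → Label q p → ℝ≥0) (n l : ℕ) :
    ∑' x, ∑ i, (if Away x i then
        if (wd x).length = l then (pathSum F n x i : ℝ≥0∞) else 0 else 0) ≤
      ∑' x, ∑ i, if Away x i then
        if (wd x).length = l + n then (F x i : ℝ≥0∞) else 0 else 0 := by
  induction n generalizing l with
  | zero => exact le_rfl
  | succ n ih =>
    refine le_trans (le_of_eq ?_) ((tsum_away_step fun x i =>
      if (wd x).length = l + 1 then (pathSum F n x i : ℝ≥0∞) else 0).trans ((ih (l + 1)).trans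
        (le_of_eq ?_)))
    · refine tsum_congr fun x => Finset.sum_congr rfl fun i _ => ?_
      by_cases h : Away x i
      · rw [if_pos h, if_pos h, h.length, pathSum]
        by_cases hl : (wd x).length = l
        · simp only [hl, if_true, ENNReal.ofNNReal_finsetSum, apply_ite ENNReal.ofNNReal,
            ENNReal.coe_zero]
        · simp [hl]
      · rw [if_neg h, if_neg h]
    · rw [add_right_comm, add_assoc]

lemma pathWeight_mul_le (n : ℕ) (i : Label q p) (P M : Matrix (Fin r) (Fin r) ℂ) :
    pathWeight b n i (P * M) ≤ frob P * pathWeight b n i M := by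
  induction n generalizing i M with
  | zero => exact frob_mul_le _ _
  | succ n ih =>
    simp only [pathWeight, Finset.mul_sum]
    refine Finset.sum_le_sum fun j _ => ?_
    split_ifs
    · rw [mul_assoc]; exact ih _ _
    · simp

/-- `awayProj` makes `freeB b` block triangular. The squared norms of both parts of the `n`-th power
are at most `∑ i, pathWeight b n i 1`, which is made smaller than `1 / 4`. -/
lemma exists_freeB_pow_lt_one (h : ∀ i, Tendsto (fun n => pathWeight b n i 1) atTop (𝓝 0)) :
    ∃ m, ‖freeB b ^ m‖ < 1 := by
  classical
  have hsum : Tendsto (fun n => ∑ i, pathWeight b n i 1) atTop (𝓝 0) := by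
    simpa using tendsto_finsetSum Finset.univ fun i _ => h i
  obtain ⟨n, hn⟩ := (hsum.eventually
    (gt_mem_nhds (show (0 : ℝ≥0) < (1 / 2) ^ 2 by positivity))).exists
  set κ := ∑ i, pathWeight b n i 1 with hκ
  have hκi : ∀ i, pathWeight b n i 1 ≤ κ := fun i =>
    Finset.single_le_sum (f := fun i => pathWeight b n i 1) (fun _ _ => by positivity)
      (Finset.mem_univ i)
  have hfin : ∀ (f g : Amp (Fin r × Label q p) (FreeProd q p)),
      ((‖g‖₊ ^ 2 : ℝ≥0) : ℝ≥0∞) ≤ κ * ((‖f‖₊ ^ 2 : ℝ≥0) : ℝ≥0∞) → ‖g‖ ≤ 1 / 2 * ‖f‖ := by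
    intro f g hfg
    rw [← ENNReal.coe_mul, ENNReal.coe_le_coe] at hfg
    have h2 : ‖g‖₊ ^ 2 ≤ (1 / 2 * ‖f‖₊) ^ 2 := by
      rw [mul_pow]
      exact hfg.trans (mul_le_mul_left hn.le _)
    have := (pow_le_pow_iff_left₀ (by positivity) (by positivity) two_ne_zero).1 h2
    exact_mod_cast this
  refine exists_norm_pow_lt_one_of_triangular (P := awayProj r q p) (n := n) ?_ ?_ ?_ ?_
  · refine ContinuousLinearMap.ext fun f => edge_ext fun x i => ?_
    rw [mul_apply_eq_comp, mul_apply_eq_comp, ev_awayProj]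
    split_ifs with ha
    · have := freeB_pow_toward b (f := (1 - awayProj r q p) f) (fun x i h => by
        have : ev ((1 - awayProj r q p) f) x i = ev f x i - ev (awayProj r q p f) x i := rfl
        rw [this, ev_awayProj, if_pos h, sub_self]) 1 x i ha
      rw [pow_one] at this
      exact this
    · rfl
  · refine ContinuousLinearMap.ext fun f => edge_ext fun x i => ?_
    rw [mul_apply_eq_comp, ev_awayProj, ev_awayProj]
    split_ifs <;> rfl
  · refine ContinuousLinearMap.opNorm_le_bound _ (by norm_num) fun f => hfin _ _ ?_
    rw [enorm_sq_edge, enorm_sq_edge, mul_apply_eq_comp]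
    calc ∑' x, ∑ i, (nsq (ev (awayProj r q p ((freeB b ^ n) f)) x i) : ℝ≥0∞)
        ≤ ∑' x, ∑ i, (κ * if Away x i then
            (pathSum (fun x i => nsq (ev f x i)) n x i : ℝ≥0∞) else 0) := by
          refine ENNReal.tsum_le_tsum fun x => Finset.sum_le_sum fun i _ => ?_
          rw [ev_awayProj]
          split_ifs
          · have := nsq_freeB_pow_le b f n x i 1
            rw [Matrix.one_mulVec] at this
            exact_mod_cast this.trans (mul_le_mul_left (hκi i) _)
          · simp
      _ = κ * ∑' x, ∑ i, if Away x i then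
            (pathSum (fun x i => nsq (ev f x i)) n x i : ℝ≥0∞) else 0 := by
          rw [← ENNReal.tsum_mul_left]
          simp only [Finset.mul_sum]
      _ ≤ κ * ∑' x, ∑ i, (nsq (ev f x i) : ℝ≥0∞) := by
          refine mul_le_mul_right ?_ _
          refine (tsum_away_pathSum_le _ n).trans ?_
          refine ENNReal.tsum_le_tsum fun x => Finset.sum_le_sum fun i _ => ?_
          split_ifs <;> simp
  · refine ContinuousLinearMap.opNorm_le_bound _ (by norm_num) fun f => hfin _ _ ?_
    set g := (1 - awayProj r q p) f with hg
    have hgv : ∀ x i, ev g x i = if Away x i then 0 else ev f x i := fun x i => by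
      have : ev g x i = ev f x i - ev (awayProj r q p f) x i := rfl
      rw [this, ev_awayProj]
      split_ifs <;> simp
    rw [enorm_sq_edge, enorm_sq_edge, mul_apply_eq_comp, ← hg]
    calc ∑' x, ∑ i, (nsq (ev ((freeB b ^ n) g) x i) : ℝ≥0∞)
        ≤ ∑' x, ∑ i, (pathWeightSum b (fun x i => nsq (ev g x i)) n x i 1 : ℝ≥0∞) := by
          refine ENNReal.tsum_le_tsum fun x => Finset.sum_le_sum fun i _ => ?_
          have := nsq_freeB_pow_le_of_toward b (f := g)
            (fun x i h => by rw [hgv, if_pos h]) n x i 1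
          rw [Matrix.one_mulVec] at this
          exact_mod_cast this
      _ = ∑ i, ∑' x, (pathWeightSum b (fun x i => nsq (ev g x i)) n x i 1 : ℝ≥0∞) :=
          Summable.tsum_finsetSum fun _ _ => ENNReal.summable
      _ ≤ ∑ i, pathWeight b n i 1 * ∑' x, ∑ i, (nsq (ev g x i) : ℝ≥0∞) :=
          Finset.sum_le_sum fun i _ => tsum_pathWeightSum_le b _ n i 1
      _ = κ * ∑' x, ∑ i, (nsq (ev g x i) : ℝ≥0∞) := by
          rw [← Finset.sum_mul, hκ]
          push_cast
          rfl
      _ ≤ κ * ∑' x, ∑ i, (nsq (ev f x i) : ℝ≥0∞) := by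
          gcongr with x i
          rw [hgv]
          split_ifs <;> simp

end NonBacktrackingOperator

/-! ### Decay of the products of weights, and a contracting power of the free non-backtracking
operator. -/

section FreeSpectralRadius

open scoped NNReal
open Filter Topology

variable {r q p : ℕ} {a₀ : Matrix (Fin r) (Fin r) ℂ} {a : Label q p → Matrix (Fin r) (Fin r) ℂ}
  {μ : ℂ}

lemma tsum_frob_block_ne_top (M : Amp (Fin r) (FreeProd q p) →L[ℂ] Amp (Fin r) (FreeProd q p)) :
    ∑' x, (frob (block M x 1) : ℝ≥0∞) ≠ ∞ := by
  have h : ∀ x, (frob (block M x 1) : ℝ≥0∞) =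
      ∑ l, ∑ k, ((‖M (deltaVec 1 (Pi.single l 1)) k x‖₊ ^ 2 : ℝ≥0) : ℝ≥0∞) := fun x => by
    rw [frob_eq_sum_col]
    push_cast
    refine Finset.sum_congr rfl fun l _ => ?_
    rw [← Matrix.mulVec_single_one, ← val_apply_deltaVec, nsq]
    push_cast
    rfl
  simp only [h]
  rw [Summable.tsum_finsetSum fun _ _ => ENNReal.summable]
  refine (ENNReal.sum_lt_top.2 fun l _ => ?_).ne
  rw [← enorm_sq_amp]
  exact ENNReal.coe_lt_top

lemma pathWeight_block (hμ : μ ∉ spectrum ℂ (freeA a₀ a)) (hG : IsUnit (Goo a₀ a μ)) (n : ℕ)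
    (y : FreeProd q p) (i : Label q p) (h : Away y i) :
    pathWeight (hatA a₀ a μ) n i (block (freeG a₀ a μ) 1 (gen i * y)) =
      pathSum (fun x i => frob (block (freeG a₀ a μ) 1 (gen i * x))) n y i := by
  induction n generalizing y i with
  | zero => rfl
  | succ n ih =>
    rw [pathWeight, pathSum]
    refine Finset.sum_congr rfl fun j _ => ?_
    split_ifs with hj
    · rw [← block_freeG_away hμ hG (h.next hj), ih _ _ (h.next hj)]
    · rfl

lemma tendsto_pathWeight_hatA (hμ : μ ∉ spectrum ℂ (freeA a₀ a)) (hG : IsUnit (Goo a₀ a μ))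
    (i : Label q p) : Tendsto (fun n => pathWeight (hatA a₀ a μ) n i 1) atTop (𝓝 0) := by
  classical
  set F : FreeProd q p → Label q p → ℝ≥0 :=
    fun x i => frob (block (freeG a₀ a μ) 1 (gen i * x)) with hF
  -- `S n` is the sum of `frob G_{ox}` over the words of length `n + 1`. Since `G_{ox} = G_{x⁻¹ o}`,
  -- the row at `o` is square-summable like a column, and `S n` tends to `0`.
  set S : ℕ → ℝ≥0∞ := fun n => ∑' x, ∑ i, if Away x i then
        if (wd x).length = n then (F x i : ℝ≥0∞) else 0 else 0 with hS
  have hSsum : ∑' n, S n ≠ ∞ := by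
    have h1 : ∑' n, S n ≤ ∑ i : Label q p, ∑' x, (F x i : ℝ≥0∞) := by
      rw [hS, ENNReal.tsum_comm, ← Summable.tsum_finsetSum fun _ _ => ENNReal.summable]
      refine ENNReal.tsum_le_tsum fun x => ?_
      rw [Summable.tsum_finsetSum fun _ _ => ENNReal.summable]
      refine Finset.sum_le_sum fun i _ => ?_
      split_ifs
      · rw [tsum_ite_eq' (wd x).length (fun _ => (F x i : ℝ≥0∞))]
      · simp
    refine ne_top_of_le_ne_top (ENNReal.sum_lt_top.2 fun i _ => ?_).ne h1
    refine lt_of_eq_of_lt ?_ (tsum_frob_block_ne_top (freeG a₀ a μ)).lt_top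
    refine Eq.trans ?_ (((Equiv.mulLeft (gen i)).trans (Equiv.inv _)).tsum_eq
      fun x => (frob (block (freeG a₀ a μ) x 1) : ℝ≥0∞))
    refine tsum_congr fun x => ?_
    have := block_freeG_mul (a₀ := a₀) (a := a) (μ := μ) 1 (gen i * x) (gen i * x)⁻¹
    rw [one_mul, mul_inv_cancel] at this
    simp only [Equiv.trans_apply, Equiv.coe_mulLeft, Equiv.inv_apply]
    rw [this]
  have hS0 : Tendsto S atTop (𝓝 0) := by
    rw [← Nat.cofinite_eq_atTop]
    exact ENNReal.tendsto_cofinite_zero_of_tsum_ne_top hSsum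
  have h1 : ∀ j, Tendsto (fun n => pathWeight (hatA a₀ a μ) n j (Goo a₀ a μ * hatA a₀ a μ j))
      atTop (𝓝 0) := by
    intro j
    rw [← ENNReal.tendsto_coe]
    refine tendsto_of_tendsto_of_tendsto_of_le_of_le tendsto_const_nhds hS0
      (fun _ => zero_le) fun n => ?_
    have := tsum_level_pathSum_le F n 0
    rw [zero_add] at this
    refine le_trans ?_ this
    refine le_trans ?_ (ENNReal.le_tsum 1)
    refine le_trans ?_ (Finset.single_le_sum (fun _ _ => zero_le) (Finset.mem_univ j))
    rw [if_pos (away_one j), wd_one, List.length_nil, if_pos rfl, Goo_mul_hatA hG,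
      ← pathWeight_block hμ hG n 1 j (away_one j), mul_one]
  have h2 : ∀ j, Tendsto (fun n => pathWeight (hatA a₀ a μ) n j (hatA a₀ a μ j))
      atTop (𝓝 0) := by
    intro j
    have h3 := (h1 j).const_mul (frob (Goo a₀ a μ)⁻¹)
    rw [mul_zero] at h3
    refine tendsto_of_tendsto_of_tendsto_of_le_of_le tendsto_const_nhds h3
      (fun _ => zero_le) fun n => ?_
    have h4 := pathWeight_mul_le (hatA a₀ a μ) n j (Goo a₀ a μ)⁻¹ (Goo a₀ a μ * hatA a₀ a μ j)
    rwa [← mul_assoc, Matrix.nonsing_inv_mul _ ((Matrix.isUnit_iff_isUnit_det _).1 hG),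
      one_mul] at h4
  rw [← tendsto_add_atTop_iff_nat 1]
  simp only [pathWeight, one_mul]
  have h5 : ∀ j, Tendsto (fun n => if j ≠ i.star then
      pathWeight (hatA a₀ a μ) n j (hatA a₀ a μ j) else 0) atTop (𝓝 0) := fun j => by
    split_ifs
    · exact h2 j
    · exact tendsto_const_nhds
  simpa only [Finset.sum_const_zero] using tendsto_finsetSum Finset.univ fun j _ => h5 j

/-- Some power of the free non-backtracking operator is a strict contraction. -/
lemma exists_freeB_hatA_pow_lt_one (h : Admissible a₀ a μ) :
    ∃ m, ‖freeB (hatA a₀ a μ) ^ m‖ < 1 :=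
  exists_freeB_pow_lt_one _
    (tendsto_pathWeight_hatA (mem_resolventSet_of_notMem_full h.1) h.2)

end FreeSpectralRadius

/-! ### Truncated resolvents -/

section Algebra

variable {q p : ℕ} {R : Type*} [Ring R]

/-- The sum over the non-backtracking paths of length `n` that start with the label `i`. -/
def pathOp (b s : Label q p → R) : ℕ → Label q p → R
  | 0, i => s i
  | n + 1, i => s i * ∑ j, if j ≠ i.star then b j * pathOp b s n j else 0

/-- The sum over the reduced words of length `n` that start with the label `i`. -/
def wordOp (b s : Label q p → R) : ℕ → Label q p → R
  | 0, _ => 0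
  | n + 1, i => b i * pathOp b s n i

/-- The sum over the reduced words of length `n`. -/
def sphereOp (b s : Label q p → R) : ℕ → R
  | 0 => 1
  | n + 1 => ∑ i, b i * pathOp b s n i

/-- The defect of the truncated resolvent. -/
def defect (b s : Label q p → R) (n : ℕ) (i : Label q p) : R :=
  pathOp b s n i - b i.star * (sphereOp b s n - wordOp b s n i)

/-- The letter `i` may be followed by any reduced word of length `n` that does not start with
`i.star`. -/
lemma pathOp_eq (b s : Label q p → R) (n : ℕ) (i : Label q p) :
    pathOp b s n i = s i * (sphereOp b s n - wordOp b s n i.star) := by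
  cases n with
  | zero => simp [pathOp, sphereOp, wordOp]
  | succ n =>
    rw [pathOp, sphereOp, wordOp]
    congr 1
    have h : ∀ j, (if j ≠ i.star then b j * pathOp b s n j else 0) =
        b j * pathOp b s n j - if j = i.star then b j * pathOp b s n j else 0 := fun j => by
      by_cases hj : j = i.star
      · rw [if_neg (not_not.2 hj), if_pos hj, sub_self]
      · rw [if_pos hj, if_neg hj, sub_zero]
    simp only [h, Finset.sum_sub_distrib, Finset.sum_ite_eq', Finset.mem_univ, if_true]

/-- The telescoping step. `h1` eliminates `h * g`, `h2` rewrites the first letter of each word as `c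
i * g * (1 - b i.star * b i)`, and `s i` cancels a leading `i.star`, which relates spheres of
neighbouring radii. -/
lemma mul_sphereOp_succ {b s c : Label q p → R} {g h : R} (hs : ∀ i, s i * s i.star = 1)
    (hsb : ∀ i j, s i * b j = b j * s i) (hsg : ∀ i, s i * g = g * s i)
    (h1 : h * g - ∑ i, c i * (g * b i.star) = 1)
    (h2 : ∀ i, c i * g * (1 - b i.star * b i) = b i) (n : ℕ) :
    (h - ∑ i, c i * s i) * (g * sphereOp b s (n + 1)) =
      ∑ i, c i * g * (defect b s n i - defect b s (n + 1) i) := by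
  have e1 : h * g = 1 + ∑ i, c i * (g * b i.star) := by rw [← h1]; abel
  have e2 : ∀ i, c i * s i * (g * sphereOp b s (n + 1)) = c i * g * (pathOp b s (n + 1) i +
      b i.star * (sphereOp b s n - wordOp b s n i)) := by
    intro i
    have e4 : s i * wordOp b s (n + 1) i.star =
        b i.star * (sphereOp b s n - wordOp b s n i) := by
      rw [wordOp, ← mul_assoc, hsb, mul_assoc, pathOp_eq, ← mul_assoc (s i), hs, one_mul,
        Label.star_star]
    rw [← e4, pathOp_eq, ← mul_add, sub_add_cancel, mul_assoc, ← mul_assoc (s i), hsg]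
    simp only [mul_assoc]
  have e3 : sphereOp b s (n + 1) =
      ∑ i, c i * g * (pathOp b s n i - b i.star * wordOp b s (n + 1) i) := by
    rw [sphereOp]
    refine Finset.sum_congr rfl fun i _ => ?_
    conv_lhs => rw [← h2 i]
    rw [wordOp]
    noncomm_ring
  have e5 : (h - ∑ i, c i * s i) * (g * sphereOp b s (n + 1)) = sphereOp b s (n + 1) +
      ∑ i, c i * (g * b i.star) * sphereOp b s (n + 1) -
      ∑ i, c i * s i * (g * sphereOp b s (n + 1)) := by
    rw [sub_mul, ← mul_assoc, e1, add_mul, one_mul, Finset.sum_mul, Finset.sum_mul]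
  rw [e5]
  nth_rw 1 [e3]
  rw [← Finset.sum_add_distrib, ← Finset.sum_sub_distrib]
  refine Finset.sum_congr rfl fun i _ => ?_
  rw [e2, defect, defect]
  noncomm_ring

/-- The truncated resolvent is an approximate right inverse. -/
lemma mul_sum_sphereOp {b s c : Label q p → R} {g h : R} (hs : ∀ i, s i * s i.star = 1)
    (hsb : ∀ i j, s i * b j = b j * s i) (hsg : ∀ i, s i * g = g * s i)
    (h1 : h * g - ∑ i, c i * (g * b i.star) = 1)
    (h2 : ∀ i, c i * g * (1 - b i.star * b i) = b i) (n : ℕ) :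
    (h - ∑ i, c i * s i) * (g * ∑ k ∈ Finset.range (n + 1), sphereOp b s k) =
      1 - ∑ i, c i * g * defect b s n i := by
  induction n with
  | zero =>
    have e1 : h * g = 1 + ∑ i, c i * (g * b i.star) := by rw [← h1]; abel
    simp only [zero_add, Finset.range_one, Finset.sum_singleton, sphereOp, mul_one, defect, pathOp,
      wordOp, sub_zero, sub_mul, e1, mul_sub, Finset.sum_sub_distrib, Finset.sum_mul, mul_assoc,
      hsg]
    abel
  | succ n ih =>
    rw [Finset.sum_range_succ, mul_add, mul_add, ih, mul_sphereOp_succ hs hsb hsg h1 h2]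
    simp only [mul_sub, Finset.sum_sub_distrib]
    abel

end Algebra

/-! ### Continuous families over a compact space -/

section Family

variable {Y A : Type*} [TopologicalSpace Y] [NormedRing A] [NormedAlgebra ℂ A]
  [CompleteSpace A]

/-- A continuous family is invertible as soon as its values are. Over a compact `Y`, Gelfand's
formula in `C(Y, A)` then gives bounds on powers that are uniform in `y`. -/
lemma mem_spectrum_family_iff {f : C(Y, A)} {z : ℂ} :
    z ∈ spectrum ℂ f ↔ ∃ y, z ∈ spectrum ℂ (f y) := by
  simp only [spectrum.mem_iff]
  rw [ContinuousMap.isUnit_iff_forall_isUnit]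
  push Not
  rfl

lemma spectralRadius_family_lt_one [CompactSpace Y] {f : C(Y, A)}
    (h : ∀ y, spectralRadius ℂ (f y) < 1) :
    spectralRadius ℂ f < 1 := by
  refine spectralRadius_lt_one_of_forall fun z hz => ?_
  obtain ⟨y, hy⟩ := mem_spectrum_family_iff.1 hz
  have : (‖z‖₊ : ℝ≥0∞) < 1 :=
    (le_iSup₂ (f := fun z (_ : z ∈ spectrum ℂ (f y)) => (‖z‖₊ : ℝ≥0∞)) z hy).trans_lt (h y)
  exact_mod_cast this

lemma spectralRadius_le_family (f : C(Y, A)) (y : Y) :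
    spectralRadius ℂ (f y) ≤ spectralRadius ℂ f :=
  iSup₂_le fun z hz => le_iSup₂ (f := fun z (_ : z ∈ spectrum ℂ f) => (‖z‖₊ : ℝ≥0∞)) z
    (mem_spectrum_family_iff.2 ⟨y, hz⟩)

lemma exists_uniform_bound_pow [CompactSpace Y] {f : C(Y, A)}
    (h : ∀ y, spectralRadius ℂ (f y) < 1) :
    ∃ u : ℕ → ℝ, Filter.Tendsto u Filter.atTop (nhds 0) ∧ ∀ n y, ‖f y ^ n‖ ≤ u n :=
  ⟨fun n => ‖f ^ n‖, tendsto_pow_of_spectralRadius_lt_one (spectralRadius_family_lt_one h),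
    fun n y => (f ^ n).norm_coe_le_norm y⟩

end Family

/-! ### Analyticity of the entries of the resolvent -/

section Analytic

open Filter Topology

variable {r q p : ℕ} (a₀ : Matrix (Fin r) (Fin r) ℂ) (a : Label q p → Matrix (Fin r) (Fin r) ℂ)

/-- The block entry as a linear map. -/
noncomputable def blockEntry (x y : FreeProd q p) (k l : Fin r) :
    (Amp (Fin r) (FreeProd q p) →L[ℂ] Amp (Fin r) (FreeProd q p)) →L[ℂ] ℂ :=
  LinearMap.mkContinuous
    { toFun := fun M => block M x y k l
      map_add' := fun _ _ => rfl
      map_smul' := fun _ _ => rfl }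
    ‖deltaVec (X := FreeProd q p) y (Pi.single l (1 : ℂ))‖ (fun M => by
      have h1 : block M x y k l = M (deltaVec y (Pi.single l 1)) k x := by
        have := congrFun (val_apply_deltaVec M y x (Pi.single l 1)) k
        rw [Matrix.mulVec_single_one] at this
        exact this.symm
      change ‖block M x y k l‖ ≤ _
      rw [h1, mul_comm]
      exact (lp.norm_apply_le_norm (by norm_num) _ x).trans
        ((PiLp.norm_apply_le _ k).trans (M.le_opNorm _)))

lemma differentiableOn_block (x y : FreeProd q p) :
    DifferentiableOn ℂ (fun μ => block (freeG a₀ a μ) x y) (spectrum ℂ (freeA a₀ a))ᶜ := by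
  intro μ hμ
  refine DifferentiableAt.differentiableWithinAt ?_
  refine differentiableAt_pi.2 fun k => differentiableAt_pi.2 fun l => ?_
  have h := (spectrum.hasDerivAt_resolvent_const_left (a := freeA a₀ a) (k := μ)
    (by simpa [spectrum] using hμ)).differentiableAt
  exact (blockEntry x y k l).differentiableAt.comp μ h

lemma differentiableOn_det_Goo :
    DifferentiableOn ℂ (fun μ => (Goo a₀ a μ).det) (spectrum ℂ (freeA a₀ a))ᶜ := by
  simp only [Matrix.det_apply]
  refine DifferentiableOn.fun_sum fun τ _ => ?_
  refine DifferentiableOn.const_smul ?_ _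
  refine DifferentiableOn.fun_finsetProd fun k _ => ?_
  have := differentiableOn_block a₀ a 1 1
  exact differentiableOn_pi.1 (differentiableOn_pi.1 this (τ k)) k

/-- `μ G(μ) = 1 + A⋆ G(μ)` tends to `1` at infinity. This excludes that the determinant vanishes
identically on an unbounded component. -/
lemma tendsto_det_Goo :
    ∀ᶠ μ in Bornology.cobounded ℂ, (Goo a₀ a μ).det ≠ 0 := by
  have h1 : Tendsto (fun μ => freeA a₀ a * freeG a₀ a μ) (Bornology.cobounded ℂ) (𝓝 0) := by
    simpa [freeG] using
      (spectrum.resolvent_tendsto_cobounded (𝕜 := ℂ) (freeA a₀ a)).const_mul (freeA a₀ a)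
  have h2 : Tendsto (fun μ : ℂ => block (1 + freeA a₀ a * freeG a₀ a μ) 1 1)
      (Bornology.cobounded ℂ) (𝓝 (block (X := FreeProd q p) (n := Fin r) 1 1 1)) := by
    refine tendsto_pi_nhds.2 fun k => tendsto_pi_nhds.2 fun l => ?_
    have := ((blockEntry (q := q) (p := p) 1 1 k l).continuous.tendsto _).comp
      (h1.const_add 1)
    rw [add_zero] at this
    exact this
  have h3 : block (X := FreeProd q p) (n := Fin r) 1 1 1 = 1 := by
    classical
    refine block_ext fun v => ?_
    rw [← val_apply_deltaVec, one_apply_eq_self, val_deltaVec, if_pos rfl, Matrix.one_mulVec]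
  rw [h3] at h2
  have h4 := (Continuous.matrix_det continuous_id).continuousAt.tendsto.comp h2
  simp only [id, Matrix.det_one] at h4
  have h5 : ∀ᶠ μ in Bornology.cobounded ℂ, μ ∉ spectrum ℂ (freeA a₀ a) :=
    Bornology.isBounded_def.1 (spectrum.isBounded (𝕜 := ℂ) (freeA a₀ a))
  filter_upwards [h4.eventually_ne one_ne_zero, h5] with μ hμ hμ' h0
  refine hμ ?_
  have h6 : 1 + freeA a₀ a * freeG a₀ a μ = μ • freeG a₀ a μ := by
    rw [← resolvent_mul hμ', sub_mul, Algebra.algebraMap_eq_smul_one, smul_mul_assoc, one_mul]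
    abel
  have h7 : block (μ • freeG a₀ a μ) 1 1 = μ • Goo a₀ a μ := rfl
  simp only [Function.comp_apply, h6, h7, Matrix.det_smul, h0, mul_zero]

end Analytic

/-! ### Realizations of the operators -/

section Algebra

variable {q p : ℕ} {R S : Type*} [Ring R] [Ring S]

lemma map_pathOp (f : R →+* S) (b s : Label q p → R) (n : ℕ) (i : Label q p) :
    f (pathOp b s n i) = pathOp (fun j => f (b j)) (fun j => f (s j)) n i := by
  induction n generalizing i with
  | zero => rfl
  | succ n ih =>
    simp only [pathOp, map_mul, map_sum, apply_ite f, map_zero, ih]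

/-- At `n + 1` the spheres and words inside the defect are fixed combinations of `pathOp` at `n`, so
they vanish in the limit too. -/
lemma tendsto_sum_defect {A : Type*} [NormedRing A] {b s : Label q p → A} (c : Label q p → A)
    (h : ∀ i, Filter.Tendsto (fun n => pathOp b s n i) Filter.atTop (nhds 0)) :
    Filter.Tendsto (fun n => ∑ i, c i * defect b s (n + 1) i) Filter.atTop (nhds 0) := by
  have hdef : ∀ i, Filter.Tendsto (fun n => defect b s (n + 1) i) Filter.atTop (nhds 0) := by
    intro i
    have h1 := (h i).comp (Filter.tendsto_add_atTop_nat 1)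
    have h2 : Filter.Tendsto (fun n => ∑ j, b j * pathOp b s n j) Filter.atTop (nhds 0) := by
      simpa using tendsto_finsetSum Finset.univ fun j _ => (h j).const_mul (b j)
    have h3 := (h i).const_mul (b i)
    have h4 := h1.sub ((h2.sub h3).const_mul (b i.star))
    rw [mul_zero, sub_zero, mul_zero, sub_zero] at h4
    exact h4
  have h5 := tendsto_finsetSum Finset.univ fun i _ => (hdef i).const_mul (c i)
  simp only [mul_zero, Finset.sum_const_zero] at h5
  exact h5

lemma map_sphereOp (f : R →+* S) (b s : Label q p → R) (n : ℕ) :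
    f (sphereOp b s n) = sphereOp (fun j => f (b j)) (fun j => f (s j)) n := by
  cases n with
  | zero => exact map_one f
  | succ n => simp only [sphereOp, map_sum, map_mul, map_pathOp]

lemma map_wordOp (f : R →+* S) (b s : Label q p → R) (n : ℕ) (i : Label q p) :
    f (wordOp b s n i) = wordOp (fun j => f (b j)) (fun j => f (s j)) n i := by
  cases n with
  | zero => exact map_zero f
  | succ n => simp only [wordOp, map_mul, map_pathOp]

/-- The defects tend to zero uniformly over a compact space if the path operators do. -/
lemma exists_sum_defect_lt {Y A : Type*} [TopologicalSpace Y] [CompactSpace Y] [NormedRing A]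
    (b s c : Label q p → C(Y, A)) {u : ℕ → ℝ} (hu : Filter.Tendsto u Filter.atTop (nhds 0))
    (h : ∀ n i y, ‖pathOp (fun j => b j y) (fun j => s j y) n i‖ ≤ u n) :
    ∃ n : ℕ, ∃ C : ℝ, C < 1 ∧
      ∀ y, ‖∑ i, c i y * defect (fun j => b j y) (fun j => s j y) n i‖ ≤ C := by
  -- Evaluations are ring homomorphisms, so the words can be formed in `C(Y, A)`, whose norm encodes
  -- uniformity in `y`.
  let e : Y → C(Y, A) →+* A := fun y => (Pi.evalRingHom _ y).comp ContinuousMap.coeFnRingHom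
  have hpath : ∀ i, Filter.Tendsto (fun n => pathOp b s n i) Filter.atTop (nhds 0) := by
    intro i
    rw [tendsto_zero_iff_norm_tendsto_zero]
    have h0 := hu.abs
    rw [abs_zero] at h0
    refine squeeze_zero (fun _ => norm_nonneg _) (fun n => ?_) h0
    refine (ContinuousMap.norm_le _ (abs_nonneg _)).2 fun y => ?_
    rw [show pathOp b s n i y = _ from map_pathOp (e y) b s n i]
    exact (h n i y).trans (le_abs_self _)
  have herr := (tendsto_sum_defect c hpath).norm
  rw [norm_zero] at herr
  obtain ⟨n, hn⟩ := (herr.eventually (gt_mem_nhds one_pos)).exists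
  refine ⟨n + 1, _, hn, fun y => ?_⟩
  refine le_of_eq_of_le ?_ (ContinuousMap.norm_coe_le_norm _ y)
  have h1 : (∑ i, c i * defect b s (n + 1) i) y = e y (∑ i, c i * defect b s (n + 1) i) := rfl
  rw [h1]
  simp only [defect, map_sum, map_mul, map_sub, map_pathOp, map_sphereOp, map_wordOp]
  rfl

end Algebra

/-- The operators `m ⊗ 1` and `1 ⊗ S_i` on a space `H` and the non-backtracking operators on a
space `K`, the sum of one copy of `H` for each label. -/
structure Realization (r q p : ℕ) (H K : Type*) [NormedAddCommGroup H] [NormedSpace ℂ H]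
    [NormedAddCommGroup K] [NormedSpace ℂ K] where
  mat : Matrix (Fin r) (Fin r) ℂ →ₐ[ℂ] (H →L[ℂ] H)
  shift : Label q p → (H →L[ℂ] H)
  proj : Label q p → (K →L[ℂ] H)
  inj : Label q p → (H →L[ℂ] K)
  nb : (Label q p → Matrix (Fin r) (Fin r) ℂ) →ₗ[ℂ] (K →L[ℂ] K)
  shift_mul_star : ∀ i, shift i * shift i.star = 1
  shift_commute : ∀ i M, Commute (shift i) (mat M)
  proj_inj : ∀ i j, (proj i).comp (inj j) = if i = j then 1 else 0
  proj_nb : ∀ b i, (proj i).comp (nb b) =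
    ∑ j, if j ≠ i.star then (mat (b j) * shift i).comp (proj j) else 0

/-! ### Continuity of the weights at admissible points. -/

section Continuity

variable {r q p : ℕ} {a₀ : Matrix (Fin r) (Fin r) ℂ} {a : Label q p → Matrix (Fin r) (Fin r) ℂ}

lemma continuousAt_hatA {μ : ℂ} (h : Admissible a₀ a μ) :
    ContinuousAt (fun μ => hatA a₀ a μ) μ := by
  have hμ := mem_resolventSet_of_notMem_full h.1
  have hopen : (spectrum ℂ (freeA a₀ a))ᶜ ∈ nhds μ :=
    (spectrum.isClosed (𝕜 := ℂ) (freeA a₀ a)).isOpen_compl.mem_nhds hμ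
  have hb : ∀ x y, ContinuousAt (fun μ => block (freeG a₀ a μ) x y) μ := fun x y =>
    ((differentiableOn_block a₀ a x y).differentiableAt hopen).continuousAt
  refine continuousAt_pi.2 fun i => ContinuousAt.mul ?_ (hb _ _)
  refine ContinuousAt.comp (f := fun μ => Goo a₀ a μ) (g := fun M => M⁻¹) ?_ (hb 1 1)
  refine continuousAt_matrix_inv _ ?_
  have := (Matrix.isUnit_iff_isUnit_det _).1 h.2
  exact NormedRing.inverse_continuousAt this.unit

end Continuity

/-! ### Truncated resolvents in a realization. -/

namespace Realization

open Filter Topology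

variable {r q p : ℕ} {H K : Type*} [NormedAddCommGroup H] [NormedSpace ℂ H]
  [NormedAddCommGroup K] [NormedSpace ℂ K] (Φ : Realization r q p H K)

/-- The operator `A` of a realization. -/
noncomputable def opA (a₀ : Matrix (Fin r) (Fin r) ℂ)
    (a : Label q p → Matrix (Fin r) (Fin r) ℂ) : H →L[ℂ] H :=
  Φ.mat a₀ + ∑ i, Φ.mat (a i) * Φ.shift i

/-- The `(i, k)` entry of the `n`-th power sums the non-backtracking paths from `i` to `k`, with the
shift of the last label `k` missing. -/
lemma pathOp_eq_sum (b : Label q p → Matrix (Fin r) (Fin r) ℂ) (n : ℕ) (i : Label q p) :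
    pathOp (fun j => Φ.mat (b j)) Φ.shift n i =
      ∑ k, (((Φ.proj i).comp (Φ.nb b ^ n)).comp (Φ.inj k)).comp (Φ.shift k) := by
  induction n generalizing i with
  | zero =>
    rw [pathOp, Finset.sum_eq_single i]
    · rw [pow_zero, show (Φ.proj i).comp 1 = Φ.proj i from ContinuousLinearMap.comp_id _,
        Φ.proj_inj, if_pos rfl]
      rfl
    · intro k _ hk
      rw [pow_zero, show (Φ.proj i).comp 1 = Φ.proj i from ContinuousLinearMap.comp_id _,
        Φ.proj_inj, if_neg (Ne.symm hk)]
      rfl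
    · simp
  | succ n ih =>
    have h1 : (Φ.proj i).comp (Φ.nb b ^ (n + 1)) =
        ∑ j, if j ≠ i.star then
          (Φ.mat (b j) * Φ.shift i).comp ((Φ.proj j).comp (Φ.nb b ^ n)) else 0 := by
      rw [pow_succ']
      change ((Φ.proj i).comp (Φ.nb b)).comp (Φ.nb b ^ n) = _
      rw [Φ.proj_nb, ContinuousLinearMap.finsetSum_comp]
      refine Finset.sum_congr rfl fun j _ => ?_
      split_ifs
      · rfl
      · exact ContinuousLinearMap.zero_comp _
    simp only [h1, ContinuousLinearMap.finsetSum_comp]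
    rw [Finset.sum_comm, pathOp, Finset.mul_sum]
    refine Finset.sum_congr rfl fun j _ => ?_
    split_ifs
    · rw [ih, ← mul_assoc, (Φ.shift_commute i _).eq, Finset.mul_sum]
      rfl
    · rw [mul_zero]
      symm
      refine Finset.sum_eq_zero fun k _ => ?_
      rw [ContinuousLinearMap.zero_comp, ContinuousLinearMap.zero_comp]

lemma norm_pathOp_le (b : Label q p → Matrix (Fin r) (Fin r) ℂ) (n : ℕ) (i : Label q p) :
    ‖pathOp (fun j => Φ.mat (b j)) Φ.shift n i‖ ≤
      (∑ k, ‖Φ.proj i‖ * ‖Φ.inj k‖ * ‖Φ.shift k‖) * ‖Φ.nb b ^ n‖ := by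
  rw [pathOp_eq_sum, Finset.sum_mul]
  refine (norm_sum_le _ _).trans (Finset.sum_le_sum fun k _ => ?_)
  calc _ ≤ ‖Φ.proj i‖ * ‖Φ.nb b ^ n‖ * ‖Φ.inj k‖ * ‖Φ.shift k‖ :=
        (ContinuousLinearMap.opNorm_comp_le _ _).trans (by
          gcongr
          refine (ContinuousLinearMap.opNorm_comp_le _ _).trans ?_
          gcongr
          exact ContinuousLinearMap.opNorm_comp_le _ _)
    _ = _ := by ring

lemma mat_eq_sum (M : Matrix (Fin r) (Fin r) ℂ) :
    Φ.mat M = ∑ k, ∑ l, M k l • Φ.mat (Matrix.single k l 1) := by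
  conv_lhs => rw [Matrix.matrix_eq_sum_single M]
  simp only [map_sum]
  refine Finset.sum_congr rfl fun k _ => Finset.sum_congr rfl fun l _ => ?_
  rw [← map_smul, Matrix.smul_single, smul_eq_mul, mul_one]

lemma continuous_mat : Continuous Φ.mat :=
  LinearMap.continuous_of_finiteDimensional Φ.mat.toLinearMap

lemma continuous_nb : Continuous Φ.nb :=
  LinearMap.continuous_of_finiteDimensional Φ.nb

variable (a₀ : Matrix (Fin r) (Fin r) ℂ) (a : Label q p → Matrix (Fin r) (Fin r) ℂ)

/-- The sum over the reduced words of length `n` that continue an edge of the free product, with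
the entries of the free resolvent as coefficients. -/
noncomputable def treeOp (μ : ℂ) : ℕ → FreeProd q p → Label q p → (H →L[ℂ] H)
  | 0, y, i => Φ.mat (block (freeG a₀ a μ) 1 (gen i * y)) * Φ.shift i
  | n + 1, y, i => Φ.shift i * ∑ j, if j ≠ i.star then treeOp μ n (gen i * y) j else 0

/-- The truncated expansion of the resolvent. -/
noncomputable def truncResolvent (N : ℕ) (μ : ℂ) : H →L[ℂ] H :=
  Φ.mat (Goo a₀ a μ) + ∑ n ∈ Finset.range N, ∑ i, Φ.treeOp a₀ a μ n 1 i

lemma differentiableOn_mat_block (x y : FreeProd q p) :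
    DifferentiableOn ℂ (fun μ => Φ.mat (block (freeG a₀ a μ) x y))
      (spectrum ℂ (freeA a₀ a))ᶜ := by
  simp only [Φ.mat_eq_sum (block _ _ _)]
  refine DifferentiableOn.fun_sum fun k _ => DifferentiableOn.fun_sum fun l _ => ?_
  exact (differentiableOn_pi.1 (differentiableOn_pi.1 (differentiableOn_block a₀ a x y) k) l
    ).smul_const _

lemma differentiableOn_treeOp (n : ℕ) (y : FreeProd q p) (i : Label q p) :
    DifferentiableOn ℂ (fun μ => Φ.treeOp a₀ a μ n y i) (spectrum ℂ (freeA a₀ a))ᶜ := by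
  induction n generalizing y i with
  | zero => exact (Φ.differentiableOn_mat_block a₀ a _ _).mul_const _
  | succ n ih =>
    refine DifferentiableOn.const_mul (DifferentiableOn.fun_sum fun j _ => ?_) _
    split_ifs
    · exact ih _ _
    · exact differentiableOn_const _

lemma differentiableOn_truncResolvent (N : ℕ) :
    DifferentiableOn ℂ (Φ.truncResolvent a₀ a N) (spectrum ℂ (freeA a₀ a))ᶜ :=
  (Φ.differentiableOn_mat_block a₀ a 1 1).add
    (DifferentiableOn.fun_sum fun n _ => DifferentiableOn.fun_sum fun i _ =>
      Φ.differentiableOn_treeOp a₀ a n 1 i)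

variable {a₀ a}

lemma treeOp_eq {μ : ℂ} (hμ : μ ∉ spectrum ℂ (freeA a₀ a)) (hG : IsUnit (Goo a₀ a μ)) (n : ℕ)
    (y : FreeProd q p) (i : Label q p) (h : Away y i) :
    Φ.treeOp a₀ a μ n y i = Φ.mat (block (freeG a₀ a μ) 1 y) *
      (Φ.mat (hatA a₀ a μ i) * pathOp (fun j => Φ.mat (hatA a₀ a μ j)) Φ.shift n i) := by
  induction n generalizing y i with
  | zero => rw [treeOp, pathOp, block_freeG_away hμ hG h, map_mul, mul_assoc]
  | succ n ih =>
    rw [treeOp, pathOp, ← mul_assoc (Φ.mat (hatA a₀ a μ i)), ← (Φ.shift_commute i _).eq,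
      mul_assoc, ← mul_assoc (Φ.mat _) (Φ.shift i), ← (Φ.shift_commute i _).eq, mul_assoc,
      ← mul_assoc (Φ.mat _) (Φ.mat _), ← map_mul, ← block_freeG_away hμ hG h]
    congr 1
    rw [Finset.mul_sum]
    refine Finset.sum_congr rfl fun j _ => ?_
    split_ifs with hj
    · exact ih _ _ (h.next hj)
    · rw [mul_zero]

/-- `truncResolvent` only involves entries of `G`, so it stays holomorphic where `G_oo` is singular
and the weights are not defined. At the other points multiplicativity identifies it with the sum
over words. -/
lemma truncResolvent_eq {μ : ℂ} (hμ : μ ∉ spectrum ℂ (freeA a₀ a)) (hG : IsUnit (Goo a₀ a μ))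
    (N : ℕ) : Φ.truncResolvent a₀ a N μ = Φ.mat (Goo a₀ a μ) *
      ∑ k ∈ Finset.range (N + 1), sphereOp (fun j => Φ.mat (hatA a₀ a μ j)) Φ.shift k := by
  rw [Finset.sum_range_succ', truncResolvent, sphereOp, mul_add, mul_one, add_comm,
    Finset.mul_sum]
  refine congrArg (fun u => u + _) (Finset.sum_congr rfl fun n _ => ?_)
  rw [sphereOp, Finset.mul_sum]
  exact Finset.sum_congr rfl fun i _ => Φ.treeOp_eq hμ hG n 1 i (away_one i)

/-- On a compact set of admissible points where the non-backtracking operators have spectral radius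
less than one, the truncated expansions are approximate inverses. -/
lemma exists_norm_truncResolvent_lt [CompleteSpace K] {Γ : Set ℂ}
    (hΓ : IsCompact Γ) (hadm : ∀ μ ∈ Γ, Admissible a₀ a μ)
    (hρ : ∀ μ ∈ Γ, spectralRadius ℂ (Φ.nb (hatA a₀ a μ)) < 1) :
    ∃ N : ℕ, ∃ C : ℝ, C < 1 ∧ ∀ μ ∈ Γ,
      ‖1 - (algebraMap ℂ (H →L[ℂ] H) μ - Φ.opA a₀ a) * Φ.truncResolvent a₀ a N μ‖ ≤ C := by
  have : CompactSpace Γ := isCompact_iff_compactSpace.1 hΓ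
  have hcont : Continuous fun μ : Γ => hatA a₀ a (μ : ℂ) := continuous_iff_continuousAt.2
    fun μ => (continuousAt_hatA (hadm μ μ.2)).comp continuousAt_subtype_val
  have hspec : ∀ μ ∈ Γ, μ ∉ spectrum ℂ (freeA a₀ a) := fun μ hμ =>
    mem_resolventSet_of_notMem_full (hadm μ hμ).1
  let B : C(Γ, K →L[ℂ] K) := ⟨fun μ => Φ.nb (hatA a₀ a μ), Φ.continuous_nb.comp hcont⟩
  obtain ⟨u, hu, hBu⟩ := exists_uniform_bound_pow (f := B) fun μ => hρ μ μ.2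
  let b : Label q p → C(Γ, H →L[ℂ] H) := fun j => ⟨fun μ => Φ.mat (hatA a₀ a μ j),
    Φ.continuous_mat.comp ((continuous_apply j).comp hcont)⟩
  let s : Label q p → C(Γ, H →L[ℂ] H) := fun j => ContinuousMap.const _ (Φ.shift j)
  let c : Label q p → C(Γ, H →L[ℂ] H) := fun j => ContinuousMap.const _ (Φ.mat (a j))
  let g : C(Γ, H →L[ℂ] H) := ⟨fun μ => Φ.mat (Goo a₀ a μ),
    continuousOn_iff_continuous_domRestrict.1
      ((Φ.differentiableOn_mat_block a₀ a 1 1).continuousOn.mono fun μ hμ => hspec μ hμ)⟩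
  obtain ⟨n, C, hC, hn⟩ := exists_sum_defect_lt b s (fun i => c i * g)
    (u := fun n => (∑ i, ∑ k, ‖Φ.proj i‖ * ‖Φ.inj k‖ * ‖Φ.shift k‖) * u n)
    (by simpa using hu.const_mul (∑ i, ∑ k, ‖Φ.proj i‖ * ‖Φ.inj k‖ * ‖Φ.shift k‖))
    (fun n i μ => by
      refine (Φ.norm_pathOp_le (hatA a₀ a μ) n i).trans ?_
      exact mul_le_mul (Finset.single_le_sum
          (f := fun i => ∑ k, ‖Φ.proj i‖ * ‖Φ.inj k‖ * ‖Φ.shift k‖)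
          (fun _ _ => by positivity) (Finset.mem_univ i)) (hBu n μ) (norm_nonneg _)
          (by positivity))
  refine ⟨n, C, hC, fun μ hμ => ?_⟩
  have hmain := mul_sum_sphereOp (b := fun j => Φ.mat (hatA a₀ a μ j)) (s := Φ.shift)
    (c := fun j => Φ.mat (a j)) (g := Φ.mat (Goo a₀ a μ)) (h := Φ.mat (μ • 1 - a₀))
    Φ.shift_mul_star (fun i j => (Φ.shift_commute i _).eq) (fun i => (Φ.shift_commute i _).eq)
    (by
      have := congrArg Φ.mat (hatA_relation_one (hspec μ hμ) (hadm μ hμ).2)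
      simpa only [map_sub Φ.mat (_ * _), map_mul, map_sum, map_one] using this)
    (fun i => by
      have := congrArg Φ.mat (hatA_relation_two (hspec μ hμ) (hadm μ hμ).2 i)
      simpa only [map_sub, map_mul, map_one] using this) n
  have h3 : Φ.mat (μ • 1 - a₀) - ∑ i, Φ.mat (a i) * Φ.shift i =
      algebraMap ℂ (H →L[ℂ] H) μ - Φ.opA a₀ a := by
    rw [opA, map_sub, map_smul, map_one, Algebra.algebraMap_eq_smul_one, sub_sub]
  rw [Φ.truncResolvent_eq (hspec μ hμ) (hadm μ hμ).2, ← h3, hmain, sub_sub_cancel]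
  exact hn ⟨μ, hμ⟩

/-- If the non-backtracking operators have spectral radius less than one on a circle of admissible
points, then `A - μ` has a right inverse for all `μ` inside the circle. -/
lemma exists_right_inverse [CompleteSpace H] [CompleteSpace K] {z : ℂ} {ρ : ℝ} (hρ0 : ρ ≠ 0)
    (hball : Metric.closedBall z ρ ⊆ (spectrum ℂ (freeA a₀ a))ᶜ)
    (hadm : ∀ μ ∈ Metric.sphere z ρ, Admissible a₀ a μ)
    (hρ : ∀ μ ∈ Metric.sphere z ρ, spectralRadius ℂ (Φ.nb (hatA a₀ a μ)) < 1) :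
    ∀ μ ∈ Metric.ball z ρ, ∃ R, (algebraMap ℂ _ μ - Φ.opA a₀ a) * R = 1 := by
  intro μ hμ
  obtain ⟨N, C, hC, h⟩ := Φ.exists_norm_truncResolvent_lt (isCompact_sphere z ρ) hadm hρ
  have hd : DifferentiableOn ℂ (fun μ : ℂ =>
      1 - (algebraMap ℂ (H →L[ℂ] H) μ - Φ.opA a₀ a) * Φ.truncResolvent a₀ a N μ)
      (closure (Metric.ball z ρ)) := by
    rw [closure_ball z hρ0]
    have h1 := (Φ.differentiableOn_truncResolvent a₀ a N).mono hball
    have h2 : Differentiable ℂ fun μ : ℂ => algebraMap ℂ (H →L[ℂ] H) μ - Φ.opA a₀ a := by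
      simp only [Algebra.algebraMap_eq_smul_one]
      fun_prop
    exact (h2.differentiableOn.mul h1).const_sub 1
  -- Maximum principle: the bound `C < 1` for the error on the circle holds inside as well, where
  -- points need not be admissible.
  have hle := Complex.norm_le_of_forall_mem_frontier_norm_le Metric.isBounded_ball hd.diffContOnCl
    (fun w hw => h w (by rwa [frontier_ball z hρ0] at hw)) (subset_closure hμ)
  have hu := isUnit_one_sub_of_norm_lt_one (hle.trans_lt hC)
  rw [sub_sub_cancel] at hu
  exact ⟨Φ.truncResolvent a₀ a N μ * ↑hu.unit⁻¹, by
    rw [← mul_assoc]; exact hu.mul_val_inv⟩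

end Realization

/-! ### Filled sets -/

section Topology

open Filter Topology

/-- A right inverse need not be an inverse, but the resolvent set is closed in the ball. If `R` is a
right inverse at a closure point `w`, then `(μ - T) * R` is invertible for `μ` near `w`; taking `μ`
in the resolvent set shows that `R` is invertible. -/
lemma ball_subset_resolventSet {A : Type*} [NormedRing A] [NormedAlgebra ℂ A] [CompleteSpace A]
    {T : A} {z : ℂ} {ρ : ℝ} (h : ∀ μ ∈ Metric.ball z ρ, ∃ R, (algebraMap ℂ A μ - T) * R = 1)
    (hne : (Metric.ball z ρ ∩ resolventSet ℂ T).Nonempty) :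
    Metric.ball z ρ ⊆ resolventSet ℂ T := by
  refine (convex_ball z ρ).isPreconnected.subset_of_closure_inter_subset
    (spectrum.isOpen_resolventSet T) hne ?_
  rintro w ⟨hw, hwb⟩
  obtain ⟨R, hR⟩ := h w hwb
  have hcont : Continuous fun μ : ℂ => (algebraMap ℂ A μ - T) * R := by
    have := continuous_algebraMap ℂ A
    fun_prop
  have hunit : ∀ᶠ μ in 𝓝 w, IsUnit ((algebraMap ℂ A μ - T) * R) :=
    hcont.continuousAt.eventually_mem (Units.isOpen.mem_nhds (by simp [hR]))
  obtain ⟨μ, hμ, hμ'⟩ := (mem_closure_iff_frequently.1 hw).and_eventually hunit |>.exists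
  have hRu : IsUnit R := (Units.isUnit_units_mul hμ.unit R).1 hμ'
  obtain ⟨u, rfl⟩ := hRu
  rw [spectrum.mem_resolventSet_iff, Units.eq_inv_of_mul_eq_one_right hR]
  exact Units.isUnit _

lemma notMem_full_iff {S : Set ℂ} {z : ℂ} :
    z ∉ full S ↔ ¬ Bornology.IsBounded (connectedComponentIn Sᶜ z) := by
  simp [full]

lemma notMem_full_of_mem_component {S : Set ℂ} {z w : ℂ} (hz : z ∉ full S)
    (hw : w ∈ connectedComponentIn Sᶜ z) : w ∉ full S := by
  rw [notMem_full_iff] at hz ⊢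
  rwa [← connectedComponentIn_eq hw]

lemma notMem_full_of_ball {S : Set ℂ} {z w w' : ℂ} {ρ : ℝ} (h : Metric.ball z ρ ⊆ Sᶜ)
    (hw' : w' ∈ Metric.ball z ρ) (hf : w' ∉ full S) (hw : w ∈ Metric.ball z ρ) : w ∉ full S :=
  notMem_full_of_mem_component hf
    ((convex_ball z ρ).isPreconnected.subset_connectedComponentIn hw' h hw)

/-- The radial ray from `w` to infinity avoids `S`. -/
lemma notMem_full_of_norm_lt {S : Set ℂ} {R : ℝ} (hS : S ⊆ Metric.closedBall 0 R) {w : ℂ}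
    (hR : 0 ≤ R) (hw : R < ‖w‖) : w ∉ full S := by
  rw [notMem_full_iff]
  have h1 : IsPreconnected ((fun t : ℝ => (t : ℂ) * w) '' Set.Ici 1) :=
    isPreconnected_Ici.image _ (by fun_prop)
  have h2 : (fun t : ℝ => (t : ℂ) * w) '' Set.Ici 1 ⊆ Sᶜ := by
    rintro _ ⟨t, ht, rfl⟩ hS'
    have := hS hS'
    rw [mem_closedBall_zero_iff, norm_mul, Complex.norm_real, Real.norm_eq_abs] at this
    have h3 : 1 ≤ |t| := le_trans ht (le_abs_self t)
    nlinarith [norm_nonneg w]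
  have h3 := h1.subset_connectedComponentIn ⟨1, Set.self_mem_Ici, by simp⟩ h2 (x := w)
  intro hb
  obtain ⟨C, hC⟩ := (hb.subset h3).exists_norm_le
  have hw0 : 0 < ‖w‖ := hR.trans_lt hw
  have := hC _ ⟨max 1 ((C + 1) / ‖w‖), Set.mem_Ici.2 (le_max_left _ _), rfl⟩
  rw [norm_mul, Complex.norm_real, Real.norm_eq_abs] at this
  have h4 : (C + 1) / ‖w‖ ≤ |max 1 ((C + 1) / ‖w‖)| := (le_max_right _ _).trans (le_abs_self _)
  rw [div_le_iff₀ hw0] at h4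
  linarith

/-- A family of closed sets that locally avoids the points outside a filled set, as soon as it
contains one point of the complement nearby, has filled sets close to the given one. -/
lemma full_subset_thickening {S₀ : Set ℂ} (Q : ℝ → Set ℂ → Prop)
    (hmono : ∀ δ δ' S, δ' ≤ δ → Q δ' S → Q δ S) {R : ℝ} (hR0 : 0 ≤ R)
    (hR : ∀ δ S, Q δ S → S ⊆ Metric.closedBall 0 R)
    (hloc : ∀ z ∉ full S₀, ∃ ρ > 0, ∃ δ > 0, ∀ S, Q δ S →
      (Metric.ball z ρ ∩ Sᶜ).Nonempty → Metric.ball z ρ ⊆ Sᶜ) {ε : ℝ} (hε : 0 < ε) :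
    ∃ δ > 0, ∀ S, Q δ S → full S ⊆ Metric.thickening ε (full S₀) := by
  -- Here `δ` may depend on the point, but neither `δ` nor the neighbourhood depends on `S`.
  set u : Set ℂ := {z | ∃ δ > 0, ∀ᶠ w in 𝓝 z, ∀ S, Q δ S → w ∉ full S} with hu
  have huo : IsOpen u := by
    rw [isOpen_iff_mem_nhds]
    rintro z ⟨δ, hδ, h⟩
    filter_upwards [eventually_eventually_nhds.2 h] with w hw using ⟨δ, hδ, hw⟩
  have hgood : ∀ z ∉ full S₀, z ∈ u := by
    intro z hz
    have hzmem : z ∈ connectedComponentIn S₀ᶜ z :=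
      mem_connectedComponentIn (mem_resolventSet_of_notMem_full hz)
    -- The open set `u` contains the points of norm above `R` and, by `hloc`, is closed in the
    -- component; so it spreads from infinity to `z`.
    refine isPreconnected_connectedComponentIn.subset_of_closure_inter_subset huo ?_ ?_ hzmem
    · obtain ⟨w, hw, hwR⟩ : ∃ w ∈ connectedComponentIn S₀ᶜ z, R < ‖w‖ := by
        by_contra! hcon
        exact notMem_full_iff.1 hz (isBounded_iff_forall_norm_le.2 ⟨R, hcon⟩)
      refine ⟨w, hw, 1, one_pos, ?_⟩
      filter_upwards [(isOpen_lt continuous_const continuous_norm).mem_nhds hwR] with v hv S hS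
      exact notMem_full_of_norm_lt (hR _ _ hS) hR0 hv
    · rintro w ⟨hwu, hw⟩
      obtain ⟨ρ, hρ, δ, hδ, h⟩ := hloc w (notMem_full_of_mem_component hz hw)
      obtain ⟨w', hw'b, δ', hδ', h'⟩ :=
        mem_closure_iff_nhds.1 hwu _ (Metric.ball_mem_nhds w hρ)
      refine ⟨min δ δ', lt_min hδ hδ', ?_⟩
      filter_upwards [Metric.ball_mem_nhds w hρ] with v hv S hS
      have hf := h'.self_of_nhds S (hmono _ _ _ (min_le_right _ _) hS)
      exact notMem_full_of_ball (h S (hmono _ _ _ (min_le_left _ _) hS)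
        ⟨w', hw'b, mem_resolventSet_of_notMem_full hf⟩) hw'b hf hv
  have hK : IsCompact (Metric.closedBall (0 : ℂ) R \ Metric.thickening ε (full S₀)) :=
    (isCompact_closedBall _ _).diff Metric.isOpen_thickening
  obtain ⟨δ, hδ, h⟩ : ∃ δ > 0, ∀ w ∈ Metric.closedBall (0 : ℂ) R \
      Metric.thickening ε (full S₀), ∀ S, Q δ S → w ∉ full S := by
    refine hK.induction_on (p := fun t => ∃ δ > 0, ∀ w ∈ t, ∀ S, Q δ S → w ∉ full S)
      ⟨1, one_pos, by simp⟩ ?_ ?_ ?_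
    · rintro s t hst ⟨δ, hδ, h⟩
      exact ⟨δ, hδ, fun w hw => h w (hst hw)⟩
    · rintro s t ⟨δ, hδ, h⟩ ⟨δ', hδ', h'⟩
      refine ⟨min δ δ', lt_min hδ hδ', fun w hw S hS => ?_⟩
      rcases hw with hw | hw
      · exact h w hw S (hmono _ _ _ (min_le_left _ _) hS)
      · exact h' w hw S (hmono _ _ _ (min_le_right _ _) hS)
    · rintro z ⟨-, hz⟩
      obtain ⟨δ, hδ, h⟩ := hgood z fun hzf => hz (Metric.self_subset_thickening hε _ hzf)
      exact ⟨_, mem_nhdsWithin_of_mem_nhds h, δ, hδ, fun w hw => hw⟩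
  refine ⟨δ, hδ, fun S hS w hw => ?_⟩
  by_contra hwt
  refine h w ⟨?_, hwt⟩ S hS hw
  rw [mem_closedBall_zero_iff]
  by_contra! hlt
  exact notMem_full_of_norm_lt (hR _ _ hS) hR0 hlt hw

end Topology

/-! ### Admissible circles -/

section Circles

open Filter Topology

variable {r q p : ℕ} (a₀ : Matrix (Fin r) (Fin r) ℂ) (a : Label q p → Matrix (Fin r) (Fin r) ℂ)

/-- The component of `z` is unbounded, so the holomorphic function `det G_oo` is not identically
zero on it. Its zeros are isolated, and a small circle around `z` avoids them even if `z` is one. -/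
lemma exists_admissible_circle {z : ℂ} (hz : z ∉ full (spectrum ℂ (freeA a₀ a))) :
    ∃ ρ > 0, Metric.closedBall z ρ ⊆ (spectrum ℂ (freeA a₀ a))ᶜ ∧
      ∀ μ ∈ Metric.sphere z ρ, Admissible a₀ a μ := by
  set s := connectedComponentIn (spectrum ℂ (freeA a₀ a))ᶜ z with hs
  have hso : IsOpen s :=
    (spectrum.isClosed (𝕜 := ℂ) (freeA a₀ a)).isOpen_compl.connectedComponentIn
  have hzs : z ∈ s := mem_connectedComponentIn (mem_resolventSet_of_notMem_full hz)
  have han : AnalyticOnNhd ℂ (fun μ => (Goo a₀ a μ).det) s :=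
    ((differentiableOn_det_Goo a₀ a).mono (connectedComponentIn_subset _ _)).analyticOnNhd hso
  have hne : ∀ᶠ μ in 𝓝[≠] z, (Goo a₀ a μ).det ≠ 0 := by
    refine (han z hzs).eventually_eq_zero_or_eventually_ne_zero.resolve_left fun h0 => ?_
    have heq := han.eqOn_zero_of_preconnected_of_eventuallyEq_zero
      isPreconnected_connectedComponentIn hzs h0
    refine notMem_full_iff.1 hz ?_
    have h1 : ∀ᶠ μ in Bornology.cobounded ℂ, μ ∉ s :=
      (tendsto_det_Goo a₀ a).mono fun μ hμ hμs => hμ (heq hμs)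
    exact Bornology.isBounded_def.2 h1
  have hev : ∀ᶠ μ in 𝓝 z, μ ∈ s ∧ (μ ≠ z → (Goo a₀ a μ).det ≠ 0) := by
    filter_upwards [hso.mem_nhds hzs, eventually_nhdsWithin_iff.1 hne] with μ h1 h2 using ⟨h1, h2⟩
  obtain ⟨ε, hε, h⟩ := Metric.eventually_nhds_iff_ball.1 hev
  have hsub : Metric.closedBall z (ε / 2) ⊆ Metric.ball z ε :=
    Metric.closedBall_subset_ball (half_lt_self hε)
  refine ⟨ε / 2, half_pos hε, fun μ hμ => connectedComponentIn_subset _ _ (h μ (hsub hμ)).1,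
    fun μ hμ => ?_⟩
  have h1 := h μ (hsub (Metric.sphere_subset_closedBall hμ))
  refine ⟨notMem_full_of_mem_component hz h1.1, ?_⟩
  rw [Matrix.isUnit_iff_isUnit_det, isUnit_iff_ne_zero]
  refine h1.2 ?_
  rintro rfl
  rw [Metric.mem_sphere, dist_self] at hμ
  linarith

end Circles

/-! ### The realization on `ℓ²(X)` and its restrictions -/

section Concrete

variable {r q p : ℕ} {X : Type*}

/-- The component of a vector of `ℂʳ ⊗ ℓ²(X) ⊗ ℂᵈ` with the label `i`. -/
noncomputable def labelProj (r : ℕ) (X : Type*) (i : Label q p) :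
    Amp (Fin r × Label q p) X →L[ℂ] Amp (Fin r) X :=
  ((PiLp.continuousLinearEquiv 2 ℂ (fun _ : Fin r => L2 X)).symm :
      (Fin r → L2 X) →L[ℂ] Amp (Fin r) X).comp
    (ContinuousLinearMap.pi fun k =>
      PiLp.proj (𝕜 := ℂ) 2 (fun _ : Fin r × Label q p => L2 X) (k, i))

/-- The inclusion of the summand of `ℂʳ ⊗ ℓ²(X) ⊗ ℂᵈ` with the label `j`. -/
noncomputable def labelInj (r : ℕ) (X : Type*) (j : Label q p) :
    Amp (Fin r) X →L[ℂ] Amp (Fin r × Label q p) X :=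
  ((PiLp.continuousLinearEquiv 2 ℂ (fun _ : Fin r × Label q p => L2 X)).symm :
      (Fin r × Label q p → L2 X) →L[ℂ] Amp (Fin r × Label q p) X).comp
    (ContinuousLinearMap.pi fun e =>
      if e.2 = j then PiLp.proj (𝕜 := ℂ) 2 (fun _ : Fin r => L2 X) e.1 else 0)

lemma labelProj_apply (i : Label q p) (f : Amp (Fin r × Label q p) X) (k : Fin r) :
    labelProj r X i f k = f (k, i) := rfl

lemma labelInj_apply (i j : Label q p) (f : Amp (Fin r) X) (k : Fin r) :
    labelInj r X j f (k, i) = if i = j then f k else 0 := by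
  change (if i = j then PiLp.proj (𝕜 := ℂ) 2 (fun _ : Fin r => L2 X) k else 0) f = _
  split_ifs <;> rfl

/-- The realization on `ℓ²(X)`. -/
noncomputable def l2Realization (r : ℕ) (σ : Label q p → Equiv.Perm X)
    (hσ : ∀ i, σ i.star = (σ i)⁻¹) :
    Realization r q p (Amp (Fin r) X) (Amp (Fin r × Label q p) X) where
  mat := matOp (Fin r) X
  shift i := tensorOp 1 (permOp (σ i))
  proj := labelProj r X
  inj := labelInj r X
  nb :=
    { toFun := fun b => opB b σ
      map_add' := fun b b' => by
        refine ContinuousLinearMap.ext fun f => edge_ext fun x i => ?_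
        change _ = ev (opB b σ f) x i + ev (opB b' σ f) x i
        rw [ev_opB, ev_opB, ev_opB, ← Finset.sum_add_distrib]
        refine Finset.sum_congr rfl fun j _ => ?_
        split_ifs
        · rw [Pi.add_apply, Matrix.add_mulVec]
        · rw [add_zero]
      map_smul' := fun c b => by
        refine ContinuousLinearMap.ext fun f => edge_ext fun x i => ?_
        change _ = c • ev (opB b σ f) x i
        rw [ev_opB, ev_opB, Finset.smul_sum]
        refine Finset.sum_congr rfl fun j _ => ?_
        split_ifs
        · rw [Pi.smul_apply, Matrix.smul_mulVec]
        · rw [smul_zero] }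
  shift_mul_star i := by
    rw [tensorOp_mul, permOp_mul, hσ, one_mul, inv_mul_cancel, permOp_one, tensorOp_one_one]
  shift_commute i M := by
    change tensorOp 1 _ * tensorOp M 1 = tensorOp M 1 * tensorOp 1 _
    rw [tensorOp_mul, tensorOp_mul, one_mul, mul_one, one_mul, mul_one]
  proj_inj i j := by
    refine ContinuousLinearMap.ext fun f => PiLp.ext fun k => ?_
    rw [ContinuousLinearMap.comp_apply, labelProj_apply, labelInj_apply]
    split_ifs <;> rfl
  proj_nb b i := by
    refine ContinuousLinearMap.ext fun f => amp_ext fun x => ?_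
    change ev (opB b σ f) x i = _
    rw [ev_opB, sum_apply, val_sum]
    refine Finset.sum_congr rfl fun j _ => ?_
    split_ifs
    · rw [ContinuousLinearMap.comp_apply, matOp_apply, tensorOp_mul, mul_one, one_mul,
        val_tensorOp_permOp]
      rfl
    · rfl

lemma l2Realization_opA (σ : Label q p → Equiv.Perm X) (hσ : ∀ i, σ i.star = (σ i)⁻¹)
    (a₀ : Matrix (Fin r) (Fin r) ℂ) (a : Label q p → Matrix (Fin r) (Fin r) ℂ) :
    (l2Realization r σ hσ).opA a₀ a = opA a₀ a σ := by
  simp only [Realization.opA, opA, l2Realization, matOp_apply, tensorOp_mul, mul_one, one_mul]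

/-- The restriction of a realization to invariant subspaces. -/
noncomputable def Realization.restrict {H K : Type*} [NormedAddCommGroup H] [NormedSpace ℂ H]
    [NormedAddCommGroup K] [NormedSpace ℂ K] (Φ : Realization r q p H K) (V : Submodule ℂ H)
    (W : Submodule ℂ K) (hmat : ∀ M, ∀ f ∈ V, Φ.mat M f ∈ V)
    (hshift : ∀ i, ∀ f ∈ V, Φ.shift i f ∈ V) (hproj : ∀ i, ∀ f ∈ W, Φ.proj i f ∈ V)
    (hinj : ∀ i, ∀ f ∈ V, Φ.inj i f ∈ W) (hnb : ∀ b, ∀ f ∈ W, Φ.nb b f ∈ W) :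
    Realization r q p V W where
  mat := AlgHom.ofLinearMap
    { toFun := fun M => (Φ.mat M).restrict (hmat M)
      map_add' := fun M N => ContinuousLinearMap.ext fun f => Subtype.ext (by
        change Φ.mat (M + N) f = Φ.mat M f + Φ.mat N f
        rw [map_add, add_apply])
      map_smul' := fun c M => ContinuousLinearMap.ext fun f => Subtype.ext (by
        change Φ.mat (c • M) f = c • Φ.mat M f
        rw [map_smul, smul_apply]) }
    (ContinuousLinearMap.ext fun f => Subtype.ext (by
      change Φ.mat 1 f = f
      rw [map_one, one_apply_eq_self]))
    (fun M N => ContinuousLinearMap.ext fun f => Subtype.ext (by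
      change Φ.mat (M * N) f = Φ.mat M (Φ.mat N f)
      rw [map_mul, mul_apply_eq_comp]))
  shift i := (Φ.shift i).restrict (hshift i)
  proj i := (Φ.proj i).restrict (hproj i)
  inj i := (Φ.inj i).restrict (hinj i)
  nb :=
    { toFun := fun b => (Φ.nb b).restrict (hnb b)
      map_add' := fun b b' => ContinuousLinearMap.ext fun f => Subtype.ext (by
        change Φ.nb (b + b') f = Φ.nb b f + Φ.nb b' f
        rw [map_add, add_apply])
      map_smul' := fun c b => ContinuousLinearMap.ext fun f => Subtype.ext (by
        change Φ.nb (c • b) f = c • Φ.nb b f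
        rw [map_smul, smul_apply]) }
  shift_mul_star i := ContinuousLinearMap.ext fun f => Subtype.ext
    (congrArg (fun T => T (f : H)) (Φ.shift_mul_star i))
  shift_commute i M := ContinuousLinearMap.ext fun f => Subtype.ext
    (congrArg (fun T => T (f : H)) (Φ.shift_commute i M).eq)
  proj_inj i j := ContinuousLinearMap.ext fun f => Subtype.ext (by
    refine (congrArg (fun T => T (f : H)) (Φ.proj_inj i j)).trans ?_
    split_ifs <;> rfl)
  proj_nb b i := ContinuousLinearMap.ext fun f => Subtype.ext (by
    refine (congrArg (fun T => T (f : K)) (Φ.proj_nb b i)).trans ?_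
    rw [sum_apply, sum_apply, Submodule.coe_sum]
    refine Finset.sum_congr rfl fun j _ => ?_
    split_ifs <;> rfl)

/-- The realization on an invariant subspace of `ℓ²(X)`. -/
noncomputable def subRealization (r : ℕ) (σ : Label q p → Equiv.Perm X)
    (hσ : ∀ i, σ i.star = (σ i)⁻¹) (U : Submodule ℂ (L2 X)) (hU : Invariant σ U) :
    Realization r q p (ampSub (Fin r) U) (ampSub (Fin r × Label q p) U) :=
  (l2Realization r σ hσ).restrict _ _
    (fun M f hf => tensorOp_mem M (fun _ hu => hu) f hf)
    (fun i f hf => tensorOp_mem 1 (hU.mem i) f hf)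
    (fun i f hf k => hf (k, i))
    (fun j f hf e => by
      change labelInj r X j f (e.1, e.2) ∈ U
      rw [labelInj_apply]
      split_ifs
      · exact hf e.1
      · exact U.zero_mem)
    (fun b f hf => opB_mem b σ hU f hf)

lemma subRealization_opA (σ : Label q p → Equiv.Perm X) (hσ : ∀ i, σ i.star = (σ i)⁻¹)
    (U : Submodule ℂ (L2 X)) (hU : Invariant σ U)
    (a₀ : Matrix (Fin r) (Fin r) ℂ) (a : Label q p → Matrix (Fin r) (Fin r) ℂ) :
    (subRealization r σ hσ U hU).opA a₀ a = restrA a₀ a σ U hU := by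
  refine ContinuousLinearMap.ext fun f => Subtype.ext ?_
  have h := congrArg (fun T => T (f : Amp (Fin r) X)) (l2Realization_opA σ hσ a₀ a)
  refine Eq.trans ?_ h
  simp only [Realization.opA, add_apply, sum_apply, Submodule.coe_add, Submodule.coe_sum]
  rfl

lemma isClosed_ampSub {n : Type*} [Fintype n] {U : Submodule ℂ (L2 X)}
    (hU : IsClosed (U : Set (L2 X))) : IsClosed (ampSub n U : Set (Amp n X)) := by
  have : (ampSub n U : Set (Amp n X)) =
      ⋂ k, (PiLp.proj (𝕜 := ℂ) 2 (fun _ : n => L2 X) k) ⁻¹' (U : Set (L2 X)) := by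
    ext f
    simp only [Set.mem_iInter, Set.mem_preimage]
    rfl
  rw [this]
  exact isClosed_iInter fun k => hU.preimage (ContinuousLinearMap.continuous _)

open scoped NNReal in
-- The bound does not depend on `X` or `σ`; it places all the spectra in one ball, the starting
-- point of the continuation from infinity.
lemma norm_tensorOp_permOp_le (M : Matrix (Fin r) (Fin r) ℂ) (σ : Equiv.Perm X) :
    ‖tensorOp M (permOp σ)‖ ≤ NNReal.sqrt (frob M) := by
  refine ContinuousLinearMap.opNorm_le_bound _ (NNReal.coe_nonneg _) fun f => ?_
  have hval : ∀ g : Amp (Fin r) X, ((‖g‖₊ ^ 2 : ℝ≥0) : ℝ≥0∞) = ∑' x, (nsq (val g x) : ℝ≥0∞) :=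
    fun g => by
      rw [enorm_sq_amp]
      refine tsum_congr fun x => ?_
      rw [nsq]
      push_cast
      rfl
  have h : ((‖tensorOp M (permOp σ) f‖₊ ^ 2 : ℝ≥0) : ℝ≥0∞) ≤ ((frob M * ‖f‖₊ ^ 2 : ℝ≥0)) := by
    rw [ENNReal.coe_mul, hval, hval,
      ← σ.tsum_eq (fun x => (nsq (val f x) : ℝ≥0∞)), ← ENNReal.tsum_mul_left]
    refine ENNReal.tsum_le_tsum fun x => ?_
    rw [val_tensorOp_permOp]
    exact_mod_cast nsq_mulVec_le _ _
  rw [ENNReal.coe_le_coe, ← NNReal.sq_sqrt (frob M), ← mul_pow] at h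
  have h' : ‖tensorOp M (permOp σ) f‖₊ ≤ NNReal.sqrt (frob M) * ‖f‖₊ :=
    (pow_le_pow_iff_left₀ (by positivity) (by positivity) two_ne_zero).1 h
  exact NNReal.coe_le_coe.2 h'

/-- A bound of the norms of the operators `A` that does not depend on the permutations. -/
noncomputable def normBound (a₀ : Matrix (Fin r) (Fin r) ℂ)
    (a : Label q p → Matrix (Fin r) (Fin r) ℂ) : ℝ :=
  (NNReal.sqrt (frob a₀) : ℝ) + ∑ i, ((NNReal.sqrt (frob (a i)) : NNReal) : ℝ)

lemma normBound_nonneg (a₀ : Matrix (Fin r) (Fin r) ℂ)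
    (a : Label q p → Matrix (Fin r) (Fin r) ℂ) : 0 ≤ normBound a₀ a := by
  unfold normBound
  positivity

lemma norm_opA_le (a₀ : Matrix (Fin r) (Fin r) ℂ) (a : Label q p → Matrix (Fin r) (Fin r) ℂ)
    (σ : Label q p → Equiv.Perm X) : ‖opA a₀ a σ‖ ≤ normBound a₀ a := by
  unfold opA normBound
  rw [← permOp_one]
  exact (norm_add_le _ _).trans (add_le_add (norm_tensorOp_permOp_le _ _)
    ((norm_sum_le _ _).trans (Finset.sum_le_sum fun i _ => norm_tensorOp_permOp_le _ _)))

lemma norm_restrict_le {H : Type*} [NormedAddCommGroup H] [NormedSpace ℂ H] (T : H →L[ℂ] H)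
    {V : Submodule ℂ H} (h : ∀ f ∈ V, T f ∈ V) : ‖T.restrict h‖ ≤ ‖T‖ :=
  ContinuousLinearMap.opNorm_le_bound _ (norm_nonneg _) fun f => T.le_opNorm f

lemma norm_restrict_pow_le {H : Type*} [NormedAddCommGroup H] [NormedSpace ℂ H] (T : H →L[ℂ] H)
    {V : Submodule ℂ H} (h : ∀ f ∈ V, T f ∈ V) (n : ℕ) : ‖T.restrict h ^ n‖ ≤ ‖T ^ n‖ := by
  refine ContinuousLinearMap.opNorm_le_bound _ (norm_nonneg _) fun f => ?_
  have hpow : ∀ n, ((T.restrict h ^ n) f : H) = (T ^ n) f := by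
    intro n
    induction n with
    | zero => rfl
    | succ n ih =>
      rw [pow_succ', pow_succ', mul_apply_eq_comp, mul_apply_eq_comp, ← ih]
      rfl
  rw [Submodule.coe_norm, hpow]
  exact (T ^ n).le_opNorm _

lemma spectralRadius_lt_one_of_opNorm_pow_lt_one {H : Type*} [NormedAddCommGroup H]
    [NormedSpace ℂ H] [CompleteSpace H] {T : H →L[ℂ] H} {n : ℕ} (hn : ‖T ^ n‖ < 1) :
    spectralRadius ℂ T < 1 :=
  spectralRadius_lt_one_of_norm_pow_lt_one hn

lemma spectralRadius_restrict_lt_one {H : Type*} [NormedAddCommGroup H] [NormedSpace ℂ H]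
    {T : H →L[ℂ] H} {V : Submodule ℂ H} [CompleteSpace V] (h : ∀ f ∈ V, T f ∈ V) {n : ℕ}
    (hn : ‖T ^ n‖ < 1) : spectralRadius ℂ (T.restrict h) < 1 :=
  spectralRadius_lt_one_of_opNorm_pow_lt_one ((norm_restrict_pow_le T h n).trans_lt hn)

lemma spectrum_subset_closedBall {H : Type*} [NormedAddCommGroup H] [NormedSpace ℂ H]
    [CompleteSpace H] {T : H →L[ℂ] H} {R : ℝ} (h : ‖T‖ ≤ R) :
    spectrum ℂ T ⊆ Metric.closedBall 0 R := by
  intro z hz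
  rw [mem_closedBall_zero_iff]
  -- Only `‖1‖ ≤ 1` is used, as the space may be zero.
  refine (spectrum.norm_le_norm_mul_of_mem hz).trans (le_trans ?_ h)
  exact mul_le_of_le_one_right (norm_nonneg _) ContinuousLinearMap.norm_id_le

end Concrete

/-! ### Comparison with the free operators -/

section Comparison

variable {r q p : ℕ} {a₀ : Matrix (Fin r) (Fin r) ℂ} {a : Label q p → Matrix (Fin r) (Fin r) ℂ}

lemma freePerm_star (i : Label q p) : freePerm i.star = (freePerm i)⁻¹ := by
  ext x
  simp [freePerm, gen_star]

lemma spectralRadius_freeB_lt_one {μ : ℂ} (h : Admissible a₀ a μ) :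
    spectralRadius ℂ (freeB (hatA a₀ a μ)) < 1 := by
  obtain ⟨m, hm⟩ := exists_freeB_hatA_pow_lt_one h
  exact spectralRadius_lt_one_of_norm_pow_lt_one hm

lemma spectralRadius_restrB_free_lt_one {μ : ℂ} (h : Admissible a₀ a μ)
    {U : Submodule ℂ (L2 (FreeProd q p))} (hU : Invariant freePerm U)
    (hc : IsClosed (U : Set (L2 (FreeProd q p)))) :
    spectralRadius ℂ (restrB (hatA a₀ a μ) freePerm U hU) < 1 := by
  have := (isClosed_ampSub (n := Fin r × Label q p) hc).completeSpace_coe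
  obtain ⟨m, hm⟩ := exists_freeB_hatA_pow_lt_one h
  exact spectralRadius_restrict_lt_one (opB_mem _ _ hU) hm

universe u

lemma exists_ball_compl_spectrum {z : ℂ} (hz : z ∉ full (spectrum ℂ (freeA a₀ a))) :
    ∃ ρ > 0, ∃ δ > 0, ∀ {H K : Type u} [NormedAddCommGroup H] [NormedSpace ℂ H]
      [NormedAddCommGroup K] [NormedSpace ℂ K] [CompleteSpace H] [CompleteSpace K]
      (Φ : Realization r q p H K),
      (∀ μ, Admissible a₀ a μ → spectralRadius ℂ (Φ.nb (hatA a₀ a μ)) <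
        spectralRadius ℂ (freeB (hatA a₀ a μ)) + ENNReal.ofReal δ) →
      (Metric.ball z ρ ∩ (spectrum ℂ (Φ.opA a₀ a))ᶜ).Nonempty →
      Metric.ball z ρ ⊆ (spectrum ℂ (Φ.opA a₀ a))ᶜ := by
  obtain ⟨ρ, hρ, hball, hadm⟩ := exists_admissible_circle a₀ a hz
  let Ψ := l2Realization r (freePerm (q := q) (p := p)) freePerm_star
  have hcont : Continuous fun μ : Metric.sphere z ρ => hatA a₀ a (μ : ℂ) :=
    continuous_iff_continuousAt.2
      fun μ => (continuousAt_hatA (hadm μ μ.2)).comp continuousAt_subtype_val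
  let B : C(Metric.sphere z ρ, Amp (Fin r × Label q p) (FreeProd q p) →L[ℂ] _) :=
    ⟨fun μ => Ψ.nb (hatA a₀ a μ), Ψ.continuous_nb.comp hcont⟩
  have hB : spectralRadius ℂ B < 1 :=
    spectralRadius_family_lt_one fun μ => spectralRadius_freeB_lt_one (hadm μ μ.2)
  have hle : ∀ μ ∈ Metric.sphere z ρ,
      spectralRadius ℂ (freeB (hatA a₀ a μ)) ≤ spectralRadius ℂ B := fun μ hμ =>
    spectralRadius_le_family B ⟨μ, hμ⟩
  have hfin : 1 - spectralRadius ℂ B ≠ ∞ := ENNReal.sub_ne_top ENNReal.one_ne_top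
  -- `spectralRadius ℂ B` bounds the free spectral radii on the whole circle. Its gap to `1` depends
  -- on free data only and is what the perturbed spectral radii may use up.
  refine ⟨ρ, hρ, (1 - spectralRadius ℂ B).toReal,
    ENNReal.toReal_pos (tsub_pos_of_lt hB).ne' hfin, ?_⟩
  intro H K _ _ _ _ _ _ Φ hΦ hne
  rw [ENNReal.ofReal_toReal hfin] at hΦ
  have hlt : ∀ μ ∈ Metric.sphere z ρ, spectralRadius ℂ (Φ.nb (hatA a₀ a μ)) < 1 := fun μ hμ => by
    refine (hΦ μ (hadm μ hμ)).trans_le ?_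
    calc _ ≤ spectralRadius ℂ B + (1 - spectralRadius ℂ B) := by gcongr; exact hle μ hμ
      _ = 1 := add_tsub_cancel_of_le hB.le
  have hres : (spectrum ℂ (Φ.opA a₀ a))ᶜ = resolventSet ℂ (Φ.opA a₀ a) := compl_compl _
  rw [hres] at hne ⊢
  exact ball_subset_resolventSet (Φ.exists_right_inverse hρ.ne' hball hadm hlt) hne

variable (a₀ a)

lemma exists_full_opA_subset {ε : ℝ} (hε : 0 < ε) : ∃ δ : ℝ, 0 < δ ∧
    ∀ (X : Type u) (σ : Label q p → Equiv.Perm X), (∀ i, σ i.star = (σ i)⁻¹) →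
      (∀ μ : ℂ, Admissible a₀ a μ → spectralRadius ℂ (opB (hatA a₀ a μ) σ) <
        spectralRadius ℂ (freeB (hatA a₀ a μ)) + ENNReal.ofReal δ) →
      full (spectrum ℂ (opA a₀ a σ)) ⊆ Metric.thickening ε (full (spectrum ℂ (freeA a₀ a))) := by
  -- The predicate ranges over the spectra for all `X` and `σ` at once, which makes `δ` independent
  -- of them.
  obtain ⟨δ, hδ, h⟩ := full_subset_thickening (S₀ := spectrum ℂ (freeA a₀ a))
    (fun δ S => ∃ (X : Type u) (σ : Label q p → Equiv.Perm X) (_ : ∀ i, σ i.star = (σ i)⁻¹),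
      (∀ μ : ℂ, Admissible a₀ a μ → spectralRadius ℂ (opB (hatA a₀ a μ) σ) <
        spectralRadius ℂ (freeB (hatA a₀ a μ)) + ENNReal.ofReal δ) ∧
      S = spectrum ℂ (opA a₀ a σ))
    (by
      rintro δ δ' S hδ ⟨X, σ, hσ, h, rfl⟩
      exact ⟨X, σ, hσ, fun μ hμ => (h μ hμ).trans_le (by gcongr), rfl⟩)
    (normBound_nonneg a₀ a)
    (by
      rintro δ S ⟨X, σ, hσ, h, rfl⟩
      exact spectrum_subset_closedBall (norm_opA_le a₀ a σ))
    (fun z hz => by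
      obtain ⟨ρ, hρ, δ, hδ, h⟩ := exists_ball_compl_spectrum hz
      refine ⟨ρ, hρ, δ, hδ, ?_⟩
      rintro S ⟨X, σ, hσ, hS, rfl⟩
      rw [← l2Realization_opA σ hσ]
      exact h (l2Realization r σ hσ) hS) hε
  exact ⟨δ, hδ, fun X σ hσ hS => h _ ⟨X, σ, hσ, hS, rfl⟩⟩

lemma exists_full_restrA_subset {ε : ℝ} (hε : 0 < ε) : ∃ δ : ℝ, 0 < δ ∧
    ∀ (X : Type u) (σ : Label q p → Equiv.Perm X), (∀ i, σ i.star = (σ i)⁻¹) →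
      ∀ (U : Submodule ℂ (L2 X)) (hU : Invariant σ U), IsClosed (U : Set (L2 X)) →
        (∀ μ : ℂ, Admissible a₀ a μ → spectralRadius ℂ (restrB (hatA a₀ a μ) σ U hU) <
          spectralRadius ℂ (freeB (hatA a₀ a μ)) + ENNReal.ofReal δ) →
        full (spectrum ℂ (restrA a₀ a σ U hU)) ⊆
          Metric.thickening ε (full (spectrum ℂ (freeA a₀ a))) := by
  obtain ⟨δ, hδ, h⟩ := full_subset_thickening (S₀ := spectrum ℂ (freeA a₀ a))
    (fun δ S => ∃ (X : Type u) (σ : Label q p → Equiv.Perm X) (_ : ∀ i, σ i.star = (σ i)⁻¹)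
      (U : Submodule ℂ (L2 X)) (hU : Invariant σ U) (_ : IsClosed (U : Set (L2 X))),
      (∀ μ : ℂ, Admissible a₀ a μ → spectralRadius ℂ (restrB (hatA a₀ a μ) σ U hU) <
        spectralRadius ℂ (freeB (hatA a₀ a μ)) + ENNReal.ofReal δ) ∧
      S = spectrum ℂ (restrA a₀ a σ U hU))
    (by
      rintro δ δ' S hδ ⟨X, σ, hσ, U, hU, hc, h, rfl⟩
      exact ⟨X, σ, hσ, U, hU, hc, fun μ hμ => (h μ hμ).trans_le (by gcongr), rfl⟩)
    (normBound_nonneg a₀ a)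
    (by
      rintro δ S ⟨X, σ, hσ, U, hU, hc, h, rfl⟩
      have := (isClosed_ampSub (n := Fin r) hc).completeSpace_coe
      exact spectrum_subset_closedBall ((norm_restrict_le _ _).trans (norm_opA_le a₀ a σ)))
    (fun z hz => by
      obtain ⟨ρ, hρ, δ, hδ, h⟩ := exists_ball_compl_spectrum hz
      refine ⟨ρ, hρ, δ, hδ, ?_⟩
      rintro S ⟨X, σ, hσ, U, hU, hc, hS, rfl⟩
      have := (isClosed_ampSub (n := Fin r) hc).completeSpace_coe
      have := (isClosed_ampSub (n := Fin r × Label q p) hc).completeSpace_coe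
      have h1 := h (subRealization r σ hσ U hU) hS
      rwa [subRealization_opA σ hσ] at h1) hε
  exact ⟨δ, hδ, fun X σ hσ U hU hc hS => h _ ⟨X, σ, hσ, U, hU, hc, hS, rfl⟩⟩

end Comparison

end NonBacktracking

open NonBacktracking in
theorem mainTheorem6 {r q p : ℕ} (hr : 0 < r) (hd : 0 < 2 * q + p)
    (a₀ : Matrix (Fin r) (Fin r) ℂ) (a : Label q p → Matrix (Fin r) (Fin r) ℂ) :
    (∀ μ : ℂ, Admissible a₀ a μ → spectralRadius ℂ (freeB (hatA a₀ a μ)) < 1) ∧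
    (∀ ε : ℝ, 0 < ε → ∃ δ : ℝ, 0 < δ ∧
      ∀ (X : Type*) [Countable X] (σ : Label q p → Equiv.Perm X),
        (∀ i, σ i.star = (σ i)⁻¹) →
        (∀ μ : ℂ, Admissible a₀ a μ →
          spectralRadius ℂ (opB (hatA a₀ a μ) σ) <
            spectralRadius ℂ (freeB (hatA a₀ a μ)) + ENNReal.ofReal δ) →
        full (spectrum ℂ (opA a₀ a σ)) ⊆ Metric.thickening ε (full (spectrum ℂ (freeA a₀ a)))) ∧
    (∀ μ : ℂ, Admissible a₀ a μ →
      ∀ (U : Submodule ℂ (L2 (FreeProd q p))) (hU : Invariant freePerm U),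
        IsClosed (U : Set (L2 (FreeProd q p))) → FiniteDimensional ℂ (L2 (FreeProd q p) ⧸ U) →
        spectralRadius ℂ (restrB (hatA a₀ a μ) freePerm U hU) < 1) ∧
    (∀ ε : ℝ, 0 < ε → ∃ δ : ℝ, 0 < δ ∧
      ∀ (X : Type*) [Countable X] (σ : Label q p → Equiv.Perm X),
        (∀ i, σ i.star = (σ i)⁻¹) →
        ∀ (U : Submodule ℂ (L2 X)) (hU : Invariant σ U),
          IsClosed (U : Set (L2 X)) → FiniteDimensional ℂ (L2 X ⧸ U) →
          (∀ μ : ℂ, Admissible a₀ a μ →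
            spectralRadius ℂ (restrB (hatA a₀ a μ) σ U hU) <
              spectralRadius ℂ (freeB (hatA a₀ a μ)) + ENNReal.ofReal δ) →
          full (spectrum ℂ (restrA a₀ a σ U hU)) ⊆
            Metric.thickening ε (full (spectrum ℂ (freeA a₀ a)))) := by
  refine ⟨fun μ hμ => spectralRadius_freeB_lt_one hμ, fun ε hε => ?_,
    fun μ hμ U hU hc _ => spectralRadius_restrB_free_lt_one hμ hU hc, fun ε hε => ?_⟩
  · obtain ⟨δ, hδ, h⟩ := exists_full_opA_subset a₀ a hε
    exact ⟨δ, hδ, fun X _ => h X⟩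
  · obtain ⟨δ, hδ, h⟩ := exists_full_restrA_subset a₀ a hε
    exact ⟨δ, hδ, fun X _ σ hσ U hU hc _ => h X σ hσ U hU hc⟩
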